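/- Let $n\to\infty$ and $p\to\infty$, and consider the linear regression model $Y_i=\sum_{j=1}^p\theta_jX_{ij}+\xi_i$, $1\le i\le n$, where $\theta=(\theta_1,\dots,\theta_p)\in\mathbb R^p$ is unknown, the $\xi_i$ are i.i.d. $\mathcal N(0,1)$ and independent of the random design $X=(X_{ij})$, and where, for each $j$, the $X_{1j},\dots,X_{nj}$ are identically distributed with $E X_{ij}=0$ and $E X_{ij}^2=1$ (the law of $X$ may depend on $n$ and $p$). Assume that (A2) all the random variables $X_{ij}$, $1\le i\le n$, $1\le j\le p$, are independent; (B1) $\max_{1\le j<l\le p}E\big[(X_{ij}X_{il})^4\big]=O(1)$ (this expectation does not depend on $i$). Let $P_\theta$ and $E_\theta$ denote the law of $Z=(X,Y)$ and the expectation when the parameter is $\theta$. Consider the U-statistic $$t_1=N^{-1/2}\sum_{1\le i<k\le n}p^{-1/2}\,Y_iY_k\sum_{j=1}^pX_{ij}X_{kj},\qquad N=\frac{n(n-1)}2,$$ and, for $\alpha\in(0,1)$, the test $\psi^1_\alpha=\mathbf 1_{\{t_1>u_\alpha\}}$ of $H_0:\theta=0$, where $u_\alpha$ is the $(1-\alpha)$-quantile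 of the standard Gaussian distribution. For $r>0$ let $\Theta_p(r)=\{\theta\in\mathbb R^p:\|\theta\|\ge r\}$, where $\|\cdot\|$ is the Euclidean norm. Then for every $\alpha\in(0,1)$: (i) the type I error satisfies $E_0\psi^1_\alpha=\alpha+o(1)$; (ii) if $p=o(n^2)$ and the radii $r_{np}>0$ satisfy $n r_{np}^2/\sqrt p\to\infty$, then the maximal type II error satisfies $\sup_{\theta\in\Theta_p(r_{np})}E_\theta(1-\psi^1_\alpha)\to0$. -/

import Mathlib

open MeasureTheory ProbabilityTheory Filter Topology

noncomputable section

namespace SparseRegression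

/-- The space of design matrices `X = (X i j)`, `n` observations (rows), `p` regressors (columns). -/
abbrev Design (n p : ℕ) : Type := Fin n → Fin p → ℝ

/-- The space of the observations `Z = (X, Y)`. -/
abbrev Obs (n p : ℕ) : Type := Design n p × (Fin n → ℝ)

/-- Standing assumptions on the law `PX` of the random design: in each column `j` the entries
`X i j` are independent and identically distributed, with `E (X i j) = 0` and `E (X i j) ^ 2 = 1`
(the second moment being `1`, hence nonzero, the entries are square integrable). -/
structure IsStandardDesign {n p : ℕ} (PX : Measure (Design n p)) : Prop where
  identDistrib : ∀ (j : Fin p) (i i' : Fin n),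
    IdentDistrib (fun X : Design n p => X i j) (fun X : Design n p => X i' j) PX PX
  indep_column : ∀ j : Fin p, iIndepFun (fun (i : Fin n) (X : Design n p) => X i j) PX
  mean_zero : ∀ (i : Fin n) (j : Fin p), ∫ X, X i j ∂PX = 0
  second_moment_one : ∀ (i : Fin n) (j : Fin p), ∫ X, (X i j) ^ 2 ∂PX = 1

/-- Independent design: all the entries `X i j` are jointly independent. -/
def IndependentDesign {n p : ℕ} (PX : Measure (Design n p)) : Prop :=
  iIndepFun (fun (q : Fin n × Fin p) (X : Design n p) => X q.1 q.2) PX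

/-- Fourth moment condition, along the limit `l`:
`max_{j < j'} E ((X i j * X i j') ^ 4) = O(1)`. The expectations take values in `[0, ∞]`,
so that their finiteness is part of the condition. -/
def BoundedProductMoments {ι : Type*} (l : Filter ι) (n p : ι → ℕ)
    (PX : ∀ m, Measure (Design (n m) (p m))) : Prop :=
  ∃ C : NNReal, ∀ᶠ m in l, ∀ (i : Fin (n m)) (j j' : Fin (p m)), j < j' →
    ∫⁻ X, ENNReal.ofReal ((X i j * X i j') ^ 4) ∂(PX m) ≤ C

/-- The response `Y i = ∑ j, θ j * X i j + ξ i`. -/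
def response {n p : ℕ} (θ : EuclideanSpace ℝ (Fin p)) (X : Design n p) (ξ : Fin n → ℝ) :
    Fin n → ℝ :=
  fun i => ∑ j, θ j * X i j + ξ i

/-- The law `P_θ` of `Z = (X, Y)`, where `X` has law `PX` and is independent of the noise `ξ`,
whose coordinates are i.i.d. standard Gaussian. -/
def modelLaw {n p : ℕ} (PX : Measure (Design n p)) (θ : EuclideanSpace ℝ (Fin p)) :
    Measure (Obs n p) :=
  (PX.prod (Measure.pi fun _ : Fin n => gaussianReal 0 1)).map
    fun w => (w.1, response θ w.1 w.2)

/-- Type I error probability `E_0 ψ` of a test `ψ`. -/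
def typeIError {n p : ℕ} (PX : Measure (Design n p)) (ψ : Obs n p → ℝ) : ℝ :=
  ∫ Z, ψ Z ∂(modelLaw PX 0)

/-- Type II error probability `E_θ (1 - ψ)` of a test `ψ` at `θ`. -/
def typeIIErrorAt {n p : ℕ} (PX : Measure (Design n p)) (ψ : Obs n p → ℝ)
    (θ : EuclideanSpace ℝ (Fin p)) : ℝ :=
  ∫ Z, (1 - ψ Z) ∂(modelLaw PX θ)

/-- Maximal type II error probability `sup_{θ ∈ Θ} E_θ (1 - ψ)` of a test `ψ` over `Θ`. -/
def typeIIError {n p : ℕ} (PX : Measure (Design n p)) (ψ : Obs n p → ℝ)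
    (Θ : Set (EuclideanSpace ℝ (Fin p))) : ℝ :=
  ⨆ θ : Θ, typeIIErrorAt PX ψ θ

/-- The alternative `Θ_p(r)`: vectors of Euclidean norm at least `r`. -/
def alternative (p : ℕ) (r : ℝ) : Set (EuclideanSpace ℝ (Fin p)) :=
  {θ | r ≤ ‖θ‖}

/-- The kernel `K (Z_i, Z_k) = p^{-1/2} Y_i Y_k ∑_j X_{ij} X_{kj}`. -/
def kernelK {n p : ℕ} (Z : Obs n p) (i k : Fin n) : ℝ :=
  (Real.sqrt p)⁻¹ * (Z.2 i * Z.2 k * ∑ j, Z.1 i j * Z.1 k j)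

/-- The U-statistic `t₁ = N^{-1/2} ∑_{i < k} K (Z_i, Z_k)`, `N = n (n - 1) / 2`. -/
def statT1 {n p : ℕ} (Z : Obs n p) : ℝ :=
  (Real.sqrt ((n : ℝ) * ((n : ℝ) - 1) / 2))⁻¹ *
    ∑ q : Fin n × Fin n with q.1 < q.2, kernelK Z q.1 q.2

/-- `u_α`, the `(1 - α)`-quantile of the standard Gaussian distribution. -/
def gaussianUpperQuantile (α : ℝ) : ℝ :=
  sInf {x : ℝ | 1 - α ≤ cdf (gaussianReal 0 1) x}

/-- The test `ψ_α^1`, the indicator of `t₁ > u_α`. -/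
def testPsi1 (n p : ℕ) (α : ℝ) : Obs n p → ℝ :=
  Set.indicator {Z | gaussianUpperQuantile α < statT1 Z} 1

end SparseRegression

end

/-
Given the noise `ξ`, the statistic `t₁` under `θ = 0` is a normalized sum over the columns of the
design of independent centred variables `∑_{i < k} ξ_i X_{ij} ξ_k X_{kj}`. Its conditional variance
is `N⁻¹ ∑_{i < k} ξ_i² ξ_k²`, which concentrates at `1`, and third absolute moments bound the
distance of its conditional characteristic function to the Gaussian one by `O(p^{-1/2})`; averaging
over `ξ` gives asymptotic normality.

Under `θ`, the vectors `Y_i X_i ∈ ℝ^p` are i.i.d. with mean `θ` and covariance bounded by a multiple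
of `1 + ‖θ‖²`. Hence `t₁` is a U-statistic with mean `(N / p)^{1/2} ‖θ‖²`, and Hoeffding's bound on
its variance together with Chebyshev's inequality controls the type II error.
-/

namespace SparseRegression

section Moments

variable {Ω : Type*} [MeasurableSpace Ω] {μ : Measure Ω} {f g : Ω → ℝ}

theorem integral_mul_le_of_integral_sq_le (hf : MemLp f 2 μ) (hg : MemLp g 2 μ) {a b : ℝ}
    (ha : 0 ≤ a) (hb : 0 ≤ b) (hfa : ∫ x, f x ^ 2 ∂μ ≤ a ^ 2) (hgb : ∫ x, g x ^ 2 ∂μ ≤ b ^ 2) :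
    ∫ x, f x * g x ∂μ ≤ a * b := by
  have hölder := integral_mul_norm_le_Lp_mul_Lq (f := f) (g := g) Real.HolderConjugate.two_two
    (by simpa using hf) (by simpa using hg)
  simp only [Real.rpow_two, Real.norm_eq_abs, sq_abs, ← Real.sqrt_eq_rpow] at hölder
  calc ∫ x, f x * g x ∂μ ≤ ∫ x, |f x| * |g x| ∂μ :=
        integral_mono (hf.integrable_mul hg) (hf.abs.integrable_mul hg.abs) fun x => by
          simpa only [abs_mul] using le_abs_self (f x * g x)
    _ ≤ a * b := hölder.trans <| mul_le_mul (Real.sqrt_le_iff.2 ⟨ha, hfa⟩)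
        (Real.sqrt_le_iff.2 ⟨hb, hgb⟩) (Real.sqrt_nonneg _) ha

theorem memLp_four_iff_integrable_pow_four (hf : AEStronglyMeasurable f μ) :
    MemLp f 4 μ ↔ Integrable (fun x => f x ^ 4) μ := by
  rw [← integrable_norm_rpow_iff hf (by norm_num) (by norm_num)]
  refine integrable_congr (ae_of_all _ fun x => ?_)
  simp only [ENNReal.toReal_ofNat, Real.norm_eq_abs]
  rw [← Nat.cast_ofNat, Real.rpow_natCast, Even.pow_abs (by decide)]

theorem integrable_pow_four (hf : MemLp f 4 μ) : Integrable (fun x => f x ^ 4) μ :=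
  (memLp_four_iff_integrable_pow_four hf.1).1 hf

theorem memLp_sq (hf : MemLp f 4 μ) : MemLp (fun x => f x ^ 2) 2 μ := by
  refine (memLp_two_iff_integrable_sq (hf.1.pow 2)).2 ?_
  simpa only [Pi.pow_apply, ← pow_mul] using integrable_pow_four hf

theorem memLp_mul_of_memLp_four (hf : MemLp f 4 μ) (hg : MemLp g 4 μ) :
    MemLp (fun x => f x * g x) 2 μ := by
  have polarization (x : Ω) : f x * g x = 2⁻¹ * ((f x + g x) ^ 2 - f x ^ 2 - g x ^ 2) := by ring
  simp only [polarization]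
  exact (((memLp_sq (hf.add hg)).sub (memLp_sq hf)).sub (memLp_sq hg)).const_mul _

theorem integrable_pow_of_le_four [IsFiniteMeasure μ] (hf : MemLp f 4 μ) {k : ℕ} (hk : k ≤ 4) :
    Integrable (fun x => f x ^ k) μ := by
  have h : MemLp f k μ := hf.mono_exponent (by exact_mod_cast hk)
  exact (integrable_norm_iff (hf.1.pow k)).1 (by simpa [norm_pow] using h.integrable_norm_pow')

theorem memLp_mul_prod {Ω' : Type*} [MeasurableSpace Ω'] {ν : Measure Ω'} [SFinite ν]
    {h : Ω' → ℝ} (hf : MemLp f 4 μ) (hh : MemLp h 4 ν) :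
    MemLp (fun z : Ω × Ω' => f z.1 * h z.2) 4 (μ.prod ν) := by
  refine (memLp_four_iff_integrable_pow_four (hf.1.comp_fst.mul hh.1.comp_snd)).2 ?_
  simpa only [Pi.mul_apply, mul_pow] using
    (integrable_pow_four hf).mul_prod (integrable_pow_four hh)

end Moments

section PiSucc

variable {E : Type*} [MeasurableSpace E] {n : ℕ} (μ : Fin (n + 1) → Measure E)
  [∀ i, SigmaFinite (μ i)]

theorem measurePreserving_piFinSuccAbove_zero_symm :
    MeasurePreserving (MeasurableEquiv.piFinSuccAbove (fun _ : Fin (n + 1) => E) 0).symm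
      ((μ 0).prod (Measure.pi fun i => μ i.succ)) (Measure.pi μ) := by
  simpa only [Fin.zero_succAbove] using (measurePreserving_piFinSuccAbove μ 0).symm

theorem piFinSuccAbove_zero_symm_apply (z : E × (Fin n → E)) :
    (MeasurableEquiv.piFinSuccAbove (fun _ : Fin (n + 1) => E) 0).symm z =
      (Fin.cons z.1 z.2 : Fin (n + 1) → E) := by
  simp [MeasurableEquiv.piFinSuccAbove_symm_apply, Fin.insertNthEquiv]

theorem integral_pi_succ (f : (Fin (n + 1) → E) → ℝ) :
    ∫ x, f x ∂Measure.pi μ =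
      ∫ z, f (Fin.cons z.1 z.2) ∂(μ 0).prod (Measure.pi fun i => μ i.succ) := by
  simpa only [piFinSuccAbove_zero_symm_apply] using
    ((measurePreserving_piFinSuccAbove_zero_symm μ).integral_comp' f).symm

theorem memLp_pi_succ_iff {q : ENNReal} {f : (Fin (n + 1) → E) → ℝ} :
    MemLp f q (Measure.pi μ) ↔
      MemLp (fun z : E × (Fin n → E) => f (Fin.cons z.1 z.2)) q
        ((μ 0).prod (Measure.pi fun i => μ i.succ)) := by
  have h := measurePreserving_piFinSuccAbove_zero_symm μ
  rw [← h.map_eq, MeasurableEquiv.memLp_map_measure_iff]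
  simp only [Function.comp_def, piFinSuccAbove_zero_symm_apply]

end PiSucc

/-- A probability law on the line with mean zero, unit variance and fourth moment at most `C`,
the assumption made on the law of each entry of the design. -/
structure IsStandardized (C : ℝ) (ν : Measure ℝ) : Prop where
  isProbabilityMeasure : IsProbabilityMeasure ν
  memLp : MemLp (fun x => x) 4 ν
  mean : ∫ x, x ∂ν = 0
  second_moment : ∫ x, x ^ 2 ∂ν = 1
  fourth_moment_le : ∫ x, x ^ 4 ∂ν ≤ C

namespace IsStandardized

variable {C : ℝ} {ν : Measure ℝ}

theorem one_le (h : IsStandardized C ν) : 1 ≤ C := by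
  have := h.isProbabilityMeasure
  have cauchySchwarz := integral_mul_le_of_integral_sq_le (memLp_sq h.memLp) (memLp_const 1)
    (Real.sqrt_nonneg C) zero_le_one
    (by simpa only [← pow_mul, Real.sq_sqrt ((integral_nonneg fun x => by positivity).trans
      h.fourth_moment_le)] using h.fourth_moment_le) (by simp)
  simpa [h.second_moment, Real.one_le_sqrt] using cauchySchwarz

variable {Ω : Type*} [MeasurableSpace Ω] {ρ : Measure Ω} [IsProbabilityMeasure ρ] {f g : Ω → ℝ}

theorem memLp_mul_add (h : IsStandardized C ν) (hf : MemLp f 4 ρ) (hg : MemLp g 4 ρ) :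
    MemLp (fun z : ℝ × Ω => z.1 * f z.2 + g z.2) 4 (ν.prod ρ) := by
  have := h.isProbabilityMeasure
  exact (memLp_mul_prod h.memLp hf).add (hg.comp_snd ν)

theorem integral_mul_add (h : IsStandardized C ν) (hf : Integrable f ρ) (hg : Integrable g ρ) :
    ∫ z, (z.1 * f z.2 + g z.2) ∂ν.prod ρ = ∫ y, g y ∂ρ := by
  have := h.isProbabilityMeasure
  have hx : Integrable (fun x : ℝ => x) ν := h.memLp.integrable (by norm_num)
  rw [integral_add (hx.mul_prod hf) (hg.comp_snd ν), integral_prod_mul (fun x : ℝ => x), h.mean,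
    integral_fun_snd]
  simp

theorem integral_mul_add_mul_mul_add (h : IsStandardized C ν) {f' g' : Ω → ℝ} (hf : MemLp f 2 ρ)
    (hg : MemLp g 2 ρ) (hf' : MemLp f' 2 ρ) (hg' : MemLp g' 2 ρ) :
    ∫ z, (z.1 * f z.2 + g z.2) * (z.1 * f' z.2 + g' z.2) ∂ν.prod ρ =
      ∫ y, f y * f' y ∂ρ + ∫ y, g y * g' y ∂ρ := by
  have := h.isProbabilityMeasure
  have h₁ : Integrable (fun z : ℝ × Ω => z.1 * (f z.2 * g' z.2 + g z.2 * f' z.2)) (ν.prod ρ) :=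
    (h.memLp.integrable (by norm_num)).mul_prod
      ((hf.integrable_mul hg').add (hg.integrable_mul hf'))
  have h₂ : Integrable (fun z : ℝ × Ω => z.1 ^ 2 * (f z.2 * f' z.2)) (ν.prod ρ) :=
    (integrable_pow_of_le_four h.memLp (by norm_num)).mul_prod (hf.integrable_mul hf')
  have h₀ : Integrable (fun z : ℝ × Ω => g z.2 * g' z.2) (ν.prod ρ) :=
    (hg.integrable_mul hg').comp_snd ν
  calc ∫ z, (z.1 * f z.2 + g z.2) * (z.1 * f' z.2 + g' z.2) ∂ν.prod ρ
      = ∫ z, (z.1 ^ 2 * (f z.2 * f' z.2) + z.1 * (f z.2 * g' z.2 + g z.2 * f' z.2) +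
          g z.2 * g' z.2) ∂ν.prod ρ := by congr with z; ring
    _ = ∫ y, f y * f' y ∂ρ + ∫ y, g y * g' y ∂ρ := by
        rw [integral_add (by exact h₂.add h₁) h₀, integral_add h₂ h₁,
          integral_prod_mul (fun x => x ^ 2) fun y => f y * f' y,
          integral_prod_mul (fun x => x) fun y => f y * g' y + g y * f' y, h.mean,
          h.second_moment, integral_fun_snd fun y => g y * g' y]
        simp

theorem integral_mul_add_pow_four_le (h : IsStandardized C ν) (hf : MemLp f 4 ρ)
    (hg : MemLp g 4 ρ) :
    ∫ z, (z.1 * f z.2 + g z.2) ^ 4 ∂ν.prod ρ ≤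
      ∫ y, g y ^ 4 ∂ρ + 8 * ∫ y, f y ^ 2 * g y ^ 2 ∂ρ + 3 * C * ∫ y, f y ^ 4 ∂ρ := by
  have := h.isProbabilityMeasure
  have hf4 := integrable_pow_four hf
  have hg4 := integrable_pow_four hg
  have hfg : Integrable (fun y => f y * g y ^ 3) ρ :=
    (hf4.add hg4).mono' (hf.1.mul (hg.1.pow 3)) <| ae_of_all _ fun y => by
      rw [Real.norm_eq_abs, abs_le, Pi.add_apply]
      constructor <;> nlinarith [sq_nonneg (f y + g y), sq_nonneg (f y ^ 2 - g y ^ 2),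
        sq_nonneg (f y * g y + g y ^ 2), sq_nonneg (f y * g y - g y ^ 2)]
  have h₀ : Integrable (fun z : ℝ × Ω => g z.2 ^ 4) (ν.prod ρ) := hg4.comp_snd ν
  have h₁ : Integrable (fun z : ℝ × Ω => z.1 * (4 * (f z.2 * g z.2 ^ 3))) (ν.prod ρ) :=
    (h.memLp.integrable (by norm_num)).mul_prod (hfg.const_mul 4)
  have h₂ : Integrable (fun z : ℝ × Ω => z.1 ^ 2 * (8 * (f z.2 ^ 2 * g z.2 ^ 2))) (ν.prod ρ) :=
    (integrable_pow_of_le_four h.memLp (by norm_num)).mul_prod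
      (((memLp_sq hf).integrable_mul (memLp_sq hg)).const_mul 8)
  have h₄ : Integrable (fun z : ℝ × Ω => z.1 ^ 4 * (3 * f z.2 ^ 4)) (ν.prod ρ) :=
    (integrable_pow_four h.memLp).mul_prod (hf4.const_mul 3)
  calc ∫ z, (z.1 * f z.2 + g z.2) ^ 4 ∂ν.prod ρ
      ≤ ∫ z, (z.1 ^ 4 * (3 * f z.2 ^ 4) + z.1 ^ 2 * (8 * (f z.2 ^ 2 * g z.2 ^ 2)) +
          z.1 * (4 * (f z.2 * g z.2 ^ 3)) + g z.2 ^ 4) ∂ν.prod ρ :=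
        integral_mono (integrable_pow_four (h.memLp_mul_add hf hg))
          (((h₄.add h₂).add h₁).add h₀)
          fun z => by nlinarith [sq_nonneg (z.1 ^ 2 * f z.2 ^ 2 - z.1 * f z.2 * g z.2)]
    _ = ∫ y, g y ^ 4 ∂ρ + 8 * ∫ y, f y ^ 2 * g y ^ 2 ∂ρ +
          3 * (∫ x, x ^ 4 ∂ν) * ∫ y, f y ^ 4 ∂ρ := by
        rw [integral_add (by exact (h₄.add h₂).add h₁) h₀,
          integral_add (by exact h₄.add h₂) h₁, integral_add h₄ h₂,
          integral_prod_mul (fun x => x ^ 4) fun y => 3 * f y ^ 4,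
          integral_prod_mul (fun x => x ^ 2) fun y => 8 * (f y ^ 2 * g y ^ 2),
          integral_prod_mul (fun x => x) fun y => 4 * (f y * g y ^ 3), h.mean,
          h.second_moment, integral_fun_snd fun y => g y ^ 4]
        simp only [integral_const_mul]
        simp
        ring
    _ ≤ _ := by
        gcongr
        exact h.fourth_moment_le

end IsStandardized

/-- The sum `∑_{i < k} ⟪v i, v k⟫` over the pairs of distinct entries of a finite sequence; the
statistic `t₁` is a multiple of it, evaluated at the sequence of vectors `Y i • X i`. -/
def pairInner {E : Type*} [NormedAddCommGroup E] [InnerProductSpace ℝ E] {n : ℕ}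
    (v : Fin n → E) : ℝ :=
  ∑ q : Fin n × Fin n with q.1 < q.2, inner ℝ (v q.1) (v q.2)

theorem pairInner_succ {E : Type*} [NormedAddCommGroup E] [InnerProductSpace ℝ E] {n : ℕ}
    (v : Fin (n + 1) → E) :
    pairInner v = inner ℝ (v 0) (∑ i : Fin n, v i.succ) + pairInner fun i : Fin n => v i.succ := by
  simp only [pairInner, Finset.sum_filter, Fintype.sum_prod_type, Fin.sum_univ_succ, inner_sum]
  simp [Fin.succ_pos]

section WeightedSums

theorem sum_mul_cons {n : ℕ} (w : Fin (n + 1) → ℝ) (t : ℝ) (y : Fin n → ℝ) :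
    ∑ i, w i * (Fin.cons t y : Fin (n + 1) → ℝ) i = t * w 0 + ∑ i : Fin n, w i.succ * y i := by
  simp [Fin.sum_univ_succ, mul_comm]

theorem pairInner_mul_cons {n : ℕ} (w : Fin (n + 1) → ℝ) (t : ℝ) (y : Fin n → ℝ) :
    (pairInner fun i => w i * (Fin.cons t y : Fin (n + 1) → ℝ) i) =
      t * (w 0 * ∑ i : Fin n, w i.succ * y i) + pairInner fun i : Fin n => w i.succ * y i := by
  rw [pairInner_succ]
  simp only [Fin.cons_zero, Fin.cons_succ, Real.inner_apply]
  ring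

variable {C : ℝ} {n : ℕ} {ν : Fin n → Measure ℝ}

theorem memLp_sum_mul (hν : ∀ i, IsStandardized C (ν i)) (w : Fin n → ℝ) :
    MemLp (fun x : Fin n → ℝ => ∑ i, w i * x i) 4 (Measure.pi ν) := by
  have := fun i => (hν i).isProbabilityMeasure
  exact memLp_finsetSum _ fun i _ =>
    ((hν i).memLp.comp_measurePreserving (measurePreserving_eval ν i)).const_mul (w i)

theorem integral_sum_mul_mul_sum_mul (hν : ∀ i, IsStandardized C (ν i)) (v w : Fin n → ℝ) :
    ∫ x : Fin n → ℝ, (∑ i, v i * x i) * ∑ i, w i * x i ∂Measure.pi ν = ∑ i, v i * w i := by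
  induction n with
  | zero => simp
  | succ n ih =>
    have := fun i => (hν i).isProbabilityMeasure
    have memLp_tail (u : Fin n → ℝ) := (memLp_sum_mul (fun i => hν (Fin.succ i)) u).mono_exponent
      (p := 2) (by norm_num)
    simp only [integral_pi_succ, sum_mul_cons]
    rw [(hν 0).integral_mul_add_mul_mul_add (memLp_const (v 0)) (memLp_tail fun i => v i.succ)
      (memLp_const (w 0)) (memLp_tail fun i => w i.succ), ih fun i => hν i.succ]
    simp [Fin.sum_univ_succ]

theorem integral_sum_mul_sq (hν : ∀ i, IsStandardized C (ν i)) (w : Fin n → ℝ) :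
    ∫ x : Fin n → ℝ, (∑ i, w i * x i) ^ 2 ∂Measure.pi ν = ∑ i, w i ^ 2 := by
  simpa only [← sq] using integral_sum_mul_mul_sum_mul hν w w

theorem integral_sum_mul_pow_four_le (hν : ∀ i, IsStandardized C (ν i)) (w : Fin n → ℝ) :
    ∫ x : Fin n → ℝ, (∑ i, w i * x i) ^ 4 ∂Measure.pi ν ≤ 4 * C * (∑ i, w i ^ 2) ^ 2 := by
  induction n with
  | zero => simp
  | succ n ih =>
    have := fun i => (hν i).isProbabilityMeasure
    have hC := (hν 0).one_le
    have step := (hν 0).integral_mul_add_pow_four_le (memLp_const (w 0))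
      (memLp_sum_mul (fun i => hν (Fin.succ i)) fun i => w i.succ)
    rw [integral_const_mul, integral_sum_mul_sq fun i => hν (Fin.succ i)] at step
    have tail := ih (fun i => hν i.succ) fun i => w i.succ
    simp only [integral_pi_succ, sum_mul_cons]
    refine step.trans ?_
    rw [Fin.sum_univ_succ]
    set s := ∑ i : Fin n, w i.succ ^ 2
    have : 0 ≤ s := by positivity
    simp only [integral_const, probReal_univ, one_smul]
    have : 0 ≤ (C - 1) * (w 0 ^ 2 * s) := mul_nonneg (by linarith) (by positivity)
    have : 0 ≤ C * w 0 ^ 4 := by positivity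
    nlinarith

theorem memLp_pairInner_mul (hν : ∀ i, IsStandardized C (ν i)) (w : Fin n → ℝ) :
    MemLp (fun x : Fin n → ℝ => pairInner fun i => w i * x i) 4 (Measure.pi ν) := by
  induction n with
  | zero => simp [pairInner]
  | succ n ih =>
    have := fun i => (hν i).isProbabilityMeasure
    simp only [memLp_pi_succ_iff, pairInner_mul_cons]
    exact (hν 0).memLp_mul_add ((memLp_sum_mul (fun i => hν (Fin.succ i)) _).const_mul (w 0))
      (ih (fun i => hν i.succ) _)

theorem integral_pairInner_mul (hν : ∀ i, IsStandardized C (ν i)) (w : Fin n → ℝ) :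
    ∫ x : Fin n → ℝ, pairInner (fun i => w i * x i) ∂Measure.pi ν = 0 := by
  induction n with
  | zero => simp [pairInner]
  | succ n ih =>
    have := fun i => (hν i).isProbabilityMeasure
    simp only [integral_pi_succ, pairInner_mul_cons]
    exact ((hν 0).integral_mul_add
      (((memLp_sum_mul (fun i => hν (Fin.succ i)) _).const_mul (w 0)).integrable (by norm_num))
      ((memLp_pairInner_mul (fun i => hν (Fin.succ i)) _).integrable (by norm_num))).trans
      (ih (fun i => hν i.succ) _)

theorem integral_pairInner_mul_sq (hν : ∀ i, IsStandardized C (ν i)) (w : Fin n → ℝ) :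
    ∫ x : Fin n → ℝ, pairInner (fun i => w i * x i) ^ 2 ∂Measure.pi ν =
      pairInner fun i => w i ^ 2 := by
  induction n with
  | zero => simp [pairInner]
  | succ n ih =>
    have := fun i => (hν i).isProbabilityMeasure
    have sum_memLp : MemLp (fun y : Fin n → ℝ => w 0 * ∑ i, w i.succ * y i) 2
        (Measure.pi fun i => ν i.succ) :=
      ((memLp_sum_mul (fun i => hν (Fin.succ i)) _).const_mul (w 0)).mono_exponent (by norm_num)
    have pairInner_memLp : MemLp (fun y : Fin n → ℝ => pairInner fun i => w i.succ * y i) 2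
        (Measure.pi fun i => ν i.succ) :=
      (memLp_pairInner_mul (fun i => hν (Fin.succ i)) _).mono_exponent (by norm_num)
    simp only [integral_pi_succ, pairInner_mul_cons, sq (_ + _ : ℝ)]
    rw [(hν 0).integral_mul_add_mul_mul_add sum_memLp pairInner_memLp sum_memLp pairInner_memLp]
    simp only [← sq, mul_pow (w 0)]
    rw [ih fun i => hν i.succ, integral_const_mul, integral_sum_mul_sq fun i => hν (Fin.succ i),
      pairInner_succ, Real.inner_apply]

theorem integral_pairInner_mul_pow_four_le (hν : ∀ i, IsStandardized C (ν i)) (w : Fin n → ℝ) :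
    ∫ x : Fin n → ℝ, pairInner (fun i => w i * x i) ^ 4 ∂Measure.pi ν ≤
      16 * C ^ 2 * (∑ i, w i ^ 2) ^ 4 := by
  induction n with
  | zero => simp [pairInner]
  | succ n ih =>
    have := fun i => (hν i).isProbabilityMeasure
    have hC := (hν 0).one_le
    have sum_memLp := memLp_sum_mul (fun i => hν (Fin.succ i)) fun i => w i.succ
    have pairInner_memLp := memLp_pairInner_mul (fun i => hν (Fin.succ i)) fun i => w i.succ
    have step := (hν 0).integral_mul_add_pow_four_le (sum_memLp.const_mul (w 0)) pairInner_memLp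
    have tail := ih (fun i => hν i.succ) fun i => w i.succ
    have sum_le := integral_sum_mul_pow_four_le (fun i => hν (Fin.succ i)) fun i => w i.succ
    simp only [integral_pi_succ, pairInner_mul_cons]
    refine step.trans ?_
    rw [Fin.sum_univ_succ]
    set s := ∑ i : Fin n, w i.succ ^ 2
    have : 0 ≤ s := by positivity
    have mixed := integral_mul_le_of_integral_sq_le (memLp_sq sum_memLp)
      (memLp_sq pairInner_memLp) (a := 2 * C * s) (b := 4 * C * s ^ 2) (by positivity)
      (by positivity) (by simp only [← pow_mul]; nlinarith) (by simp only [← pow_mul]; nlinarith)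
    simp only [mul_pow (w 0), mul_assoc (w 0 ^ 2), integral_const_mul]
    calc _ ≤ 16 * C ^ 2 * s ^ 4 + 8 * (w 0 ^ 2 * (2 * C * s * (4 * C * s ^ 2))) +
          3 * C * (w 0 ^ 4 * (4 * C * s ^ 2)) := by gcongr
      _ ≤ 16 * C ^ 2 * (w 0 ^ 2 + s) ^ 4 := by
        have : 0 ≤ C ^ 2 * w 0 ^ 4 * s ^ 2 := by positivity
        have : 0 ≤ C ^ 2 * w 0 ^ 6 * s := by positivity
        have : 0 ≤ C ^ 2 * w 0 ^ 8 := by positivity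
        linarith

theorem pairInner_le_sum_sq {u : Fin n → ℝ} (hu : ∀ i, 0 ≤ u i) :
    pairInner u ≤ (∑ i, u i) ^ 2 := by
  rw [sq, Finset.sum_mul_sum, ← Fintype.sum_prod_type' fun i k => u i * u k]
  simp only [pairInner, Real.inner_apply]
  exact Finset.sum_le_univ_sum_of_nonneg fun q => mul_nonneg (hu _) (hu _)

theorem integral_abs_pairInner_mul_pow_three_le (hν : ∀ i, IsStandardized C (ν i))
    (hC : 0 ≤ C) (w : Fin n → ℝ) :
    ∫ x : Fin n → ℝ, |pairInner fun i => w i * x i| ^ 3 ∂Measure.pi ν ≤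
      4 * C * (∑ i, w i ^ 2) ^ 3 := by
  have := fun i => (hν i).isProbabilityMeasure
  have memLp := memLp_pairInner_mul hν w
  have sq_le := pairInner_le_sum_sq fun i => sq_nonneg (w i)
  calc ∫ x : Fin n → ℝ, |pairInner fun i => w i * x i| ^ 3 ∂Measure.pi ν
      = ∫ x : Fin n → ℝ, |pairInner fun i => w i * x i| * pairInner (fun i => w i * x i) ^ 2
          ∂Measure.pi ν := by simp only [← sq_abs (pairInner _), pow_succ' _ 2]
    _ ≤ (∑ i, w i ^ 2) * (4 * C * (∑ i, w i ^ 2) ^ 2) :=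
        integral_mul_le_of_integral_sq_le (memLp.mono_exponent (by norm_num)).abs (memLp_sq memLp)
          (by positivity) (by positivity)
          (by simpa only [Pi.abs_apply, sq_abs, integral_pairInner_mul_sq hν] using sq_le)
          (by
            simp only [← pow_mul]
            exact (integral_pairInner_mul_pow_four_le hν w).trans_eq (by ring))
    _ = 4 * C * (∑ i, w i ^ 2) ^ 3 := by ring

end WeightedSums

section UStatistic

variable {E : Type*} [NormedAddCommGroup E] [InnerProductSpace ℝ E]

theorem pairInner_eq_centered {n : ℕ} (θ : E) (u : Fin n → E) :
    pairInner u = (n : ℝ) * (n - 1) / 2 * ‖θ‖ ^ 2 + (n - 1) * inner ℝ (∑ i, (u i - θ)) θ +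
      pairInner fun i => u i - θ := by
  induction n with
  | zero => simp [pairInner]
  | succ n ih =>
    have tail_sum : ∑ i : Fin n, u i.succ = ∑ i : Fin n, (u i.succ - θ) + (n : ℝ) • θ := by
      simp [Finset.sum_sub_distrib, Nat.cast_smul_eq_nsmul]
    rw [pairInner_succ, pairInner_succ (fun i => u i - θ), ih, tail_sum, Fin.sum_univ_succ]
    obtain ⟨c, hc⟩ : ∃ c, u 0 = c + θ := ⟨u 0 - θ, by abel⟩
    generalize ∑ i : Fin n, (u i.succ - θ) = s
    simp only [hc, add_sub_cancel_right, inner_add_left, inner_add_right, inner_smul_right,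
      real_inner_self_eq_norm_sq, real_inner_comm s θ]
    push_cast
    ring

theorem pairInner_sub_cons {n : ℕ} (θ a : E) (y : Fin n → E) :
    (pairInner fun i => (Fin.cons a y : Fin (n + 1) → E) i - θ) =
      inner ℝ (a - θ) (∑ i, (y i - θ)) + pairInner fun i => y i - θ := by
  rw [pairInner_succ]
  simp only [Fin.cons_zero, Fin.cons_succ]

variable [MeasurableSpace E]

/-- A square integrable probability law on `E` with mean `θ`, whose covariance operator is bounded
by `lam` in the sense of quadratic forms; the summands of the U-statistic have such laws. -/
structure HasMeanCovLE (θ : E) (lam : ℝ) (τ : Measure E) : Prop where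
  isProbabilityMeasure : IsProbabilityMeasure τ
  memLp : MemLp (fun u => u) 2 τ
  mean : ∫ u, u ∂τ = θ
  variance_inner_le : ∀ v, Var[fun u => inner ℝ u v; τ] ≤ lam * ‖v‖ ^ 2

namespace HasMeanCovLE

variable {θ : E} {lam : ℝ} {τ : Measure E}

theorem memLp_sub (h : HasMeanCovLE θ lam τ) : MemLp (fun u => u - θ) 2 τ :=
  have := h.isProbabilityMeasure
  h.memLp.sub (memLp_const θ)

theorem integral_inner_sub [CompleteSpace E] (h : HasMeanCovLE θ lam τ) (v : E) :
    ∫ u, inner ℝ (u - θ) v ∂τ = 0 := by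
  have := h.isProbabilityMeasure
  have hu : Integrable (fun u : E => u) τ := h.memLp.integrable (by norm_num)
  have hc : Integrable (fun _ : E => θ) τ := integrable_const θ
  simp_rw [real_inner_comm v]
  rw [integral_inner (f := fun u => u - θ) (hu.sub hc), integral_sub hu hc, h.mean]
  simp

theorem variance_inner_sub_le (h : HasMeanCovLE θ lam τ) (v : E) :
    Var[fun u => inner ℝ (u - θ) v; τ] ≤ lam * ‖v‖ ^ 2 := by
  have := h.isProbabilityMeasure
  simp_rw [inner_sub_left]
  rw [variance_sub_const (h.memLp.1.inner aestronglyMeasurable_const)]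
  exact h.variance_inner_le v

theorem integral_inner_sub_sq_le [CompleteSpace E] (h : HasMeanCovLE θ lam τ) (v : E) :
    ∫ u, inner ℝ (u - θ) v ^ 2 ∂τ ≤ lam * ‖v‖ ^ 2 := by
  rw [← variance_of_integral_eq_zero (h.memLp_sub.1.inner aestronglyMeasurable_const).aemeasurable
    (h.integral_inner_sub v)]
  exact h.variance_inner_sub_le v

variable {Y : Type*} [MeasurableSpace Y] {ρ : Measure Y} [IsProbabilityMeasure ρ]
  {f : Y → E} {g : Y → ℝ}

theorem memLp_inner_add (h : HasMeanCovLE θ lam τ) (hf : MemLp f 2 ρ) (hg : MemLp g 2 ρ) :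
    MemLp (fun z : E × Y => inner ℝ (z.1 - θ) (f z.2) + g z.2) 2 (τ.prod ρ) := by
  have := h.isProbabilityMeasure
  refine MemLp.add ?_ (hg.comp_snd τ)
  have norm_mul : MemLp (fun z : E × Y => ‖z.1 - θ‖ * ‖f z.2‖) 2 (τ.prod ρ) := by
    refine (memLp_two_iff_integrable_sq
      (h.memLp_sub.norm.1.comp_fst.mul hf.norm.1.comp_snd)).2 ?_
    simpa only [Pi.mul_apply, mul_pow] using
      h.memLp_sub.norm.integrable_sq.mul_prod hf.norm.integrable_sq
  exact norm_mul.mono (h.memLp_sub.1.comp_fst.inner hf.1.comp_snd)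
    (ae_of_all _ fun z => (norm_inner_le_norm _ _).trans (le_abs_self _))

theorem integral_inner_add_sq_le [CompleteSpace E] (h : HasMeanCovLE θ lam τ)
    (hf : MemLp f 2 ρ) (hg : MemLp g 2 ρ) :
    ∫ z, (inner ℝ (z.1 - θ) (f z.2) + g z.2) ^ 2 ∂τ.prod ρ ≤
      lam * ∫ y, ‖f y‖ ^ 2 ∂ρ + ∫ y, g y ^ 2 ∂ρ := by
  have := h.isProbabilityMeasure
  have hi := (h.memLp_inner_add hf hg).integrable_sq
  have hf2 : Integrable (fun y => lam * ‖f y‖ ^ 2) ρ := hf.norm.integrable_sq.const_mul lam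
  rw [integral_prod_symm _ hi, ← integral_const_mul, ← integral_add hf2 hg.integrable_sq]
  refine integral_mono hi.integral_prod_right (hf2.add hg.integrable_sq) fun y => ?_
  have hin : MemLp (fun u => inner ℝ (u - θ) (f y)) 2 τ := h.memLp_sub.inner_const (f y)
  have h₁ : Integrable (fun u => inner ℝ (u - θ) (f y) ^ 2) τ := hin.integrable_sq
  have h₂ : Integrable (fun u => 2 * g y * inner ℝ (u - θ) (f y)) τ :=
    (hin.integrable (by norm_num)).const_mul _
  have expand (u : E) : (inner ℝ (u - θ) (f y) + g y) ^ 2 =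
      inner ℝ (u - θ) (f y) ^ 2 + 2 * g y * inner ℝ (u - θ) (f y) + g y ^ 2 := by ring
  simp only [expand]
  rw [integral_add (by exact h₁.add h₂) (integrable_const _), integral_add h₁ h₂,
    integral_const_mul, h.integral_inner_sub]
  simpa using h.integral_inner_sub_sq_le (f y)

end HasMeanCovLE

variable {θ : E} {lam : ℝ} {n : ℕ} {τ : Fin n → Measure E}

theorem memLp_sum_sub (hτ : ∀ i, HasMeanCovLE θ lam (τ i)) :
    MemLp (fun u : Fin n → E => ∑ i, (u i - θ)) 2 (Measure.pi τ) := by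
  have := fun i => (hτ i).isProbabilityMeasure
  exact memLp_finsetSum _ fun i _ =>
    (hτ i).memLp_sub.comp_measurePreserving (measurePreserving_eval τ i)

variable [FiniteDimensional ℝ E]

theorem integral_inner_sum_sub (hτ : ∀ i, HasMeanCovLE θ lam (τ i)) (v : E) :
    ∫ u : Fin n → E, inner ℝ (∑ i, (u i - θ)) v ∂Measure.pi τ = 0 := by
  have := fun i => (hτ i).isProbabilityMeasure
  have hmem (i : Fin n) : MemLp (fun u => inner ℝ (u - θ) v) 2 (τ i) :=
    (hτ i).memLp_sub.inner_const v
  have integrable_inner (i : Fin n) :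
      Integrable (fun u : Fin n → E => inner ℝ (u i - θ) v) (Measure.pi τ) :=
    ((hmem i).comp_measurePreserving (measurePreserving_eval τ i)).integrable (by norm_num)
  simp only [sum_inner]
  rw [integral_finsetSum _ fun i _ => integrable_inner i]
  refine Finset.sum_eq_zero fun i _ => ?_
  rw [integral_comp_eval (μ := τ) (i := i) (f := fun u : E => inner ℝ (u - θ) v) (hmem i).1,
    (hτ i).integral_inner_sub]

theorem integral_inner_sum_sub_sq_le (hτ : ∀ i, HasMeanCovLE θ lam (τ i)) (v : E) :
    ∫ u : Fin n → E, inner ℝ (∑ i, (u i - θ)) v ^ 2 ∂Measure.pi τ ≤ n * (lam * ‖v‖ ^ 2) := by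
  have := fun i => (hτ i).isProbabilityMeasure
  have hmem : MemLp (fun u : Fin n → E => inner ℝ (∑ i, (u i - θ)) v) 2 (Measure.pi τ) :=
    (memLp_sum_sub hτ).inner_const v
  have hmem' (i : Fin n) : MemLp (fun u => inner ℝ (u - θ) v) 2 (τ i) :=
    (hτ i).memLp_sub.inner_const v
  rw [← variance_of_integral_eq_zero hmem.1.aemeasurable (integral_inner_sum_sub hτ v)]
  calc Var[fun u : Fin n → E => inner ℝ (∑ i, (u i - θ)) v; Measure.pi τ]
      = ∑ i, Var[fun u => inner ℝ (u - θ) v; τ i] := by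
        rw [← variance_sum_pi hmem']
        congr 1
        ext u
        rw [sum_inner, Finset.sum_apply]
    _ ≤ ∑ _i : Fin n, lam * ‖v‖ ^ 2 := Finset.sum_le_sum fun i _ => (hτ i).variance_inner_sub_le v
    _ = n * (lam * ‖v‖ ^ 2) := by simp

theorem integral_norm_sum_sub_sq_le (hτ : ∀ i, HasMeanCovLE θ lam (τ i)) :
    ∫ u : Fin n → E, ‖∑ i, (u i - θ)‖ ^ 2 ∂Measure.pi τ ≤ n * (lam * Module.finrank ℝ E) := by
  let b := stdOrthonormalBasis ℝ E
  have parseval (x : E) : ‖x‖ ^ 2 = ∑ j, inner ℝ x (b j) ^ 2 := by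
    rw [← b.sum_sq_norm_inner_left x]
    simp
  have hmem (v : E) : MemLp (fun u : Fin n → E => inner ℝ (∑ i, (u i - θ)) v) 2 (Measure.pi τ) :=
    (memLp_sum_sub hτ).inner_const v
  simp only [parseval]
  rw [integral_finsetSum _ fun j _ => (hmem (b j)).integrable_sq]
  calc ∑ j, ∫ u : Fin n → E, inner ℝ (∑ i, (u i - θ)) (b j) ^ 2 ∂Measure.pi τ
      ≤ ∑ j, n * (lam * ‖b j‖ ^ 2) :=
        Finset.sum_le_sum fun j _ => integral_inner_sum_sub_sq_le hτ (b j)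
    _ = n * (lam * Module.finrank ℝ E) := by
        simp
        ring

theorem memLp_pairInner_sub (hτ : ∀ i, HasMeanCovLE θ lam (τ i)) :
    MemLp (fun u : Fin n → E => pairInner fun i => u i - θ) 2 (Measure.pi τ) := by
  induction n with
  | zero => simp [pairInner]
  | succ n ih =>
    have := fun i => (hτ i).isProbabilityMeasure
    simp only [memLp_pi_succ_iff, pairInner_sub_cons]
    exact (hτ 0).memLp_inner_add (memLp_sum_sub fun i => hτ (Fin.succ i)) (ih fun i => hτ i.succ)

theorem integral_pairInner_sub_sq_le (hlam : 0 ≤ lam) (hτ : ∀ i, HasMeanCovLE θ lam (τ i)) :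
    ∫ u : Fin n → E, (pairInner fun i => u i - θ) ^ 2 ∂Measure.pi τ ≤
      n ^ 2 * (lam ^ 2 * Module.finrank ℝ E) := by
  induction n with
  | zero => simp [pairInner]
  | succ n ih =>
    have := fun i => (hτ i).isProbabilityMeasure
    simp only [integral_pi_succ, pairInner_sub_cons]
    calc _ ≤ lam * ∫ y : Fin n → E, ‖∑ i, (y i - θ)‖ ^ 2 ∂(Measure.pi fun i => τ i.succ) +
          ∫ y : Fin n → E, (pairInner fun i => y i - θ) ^ 2 ∂(Measure.pi fun i => τ i.succ) :=
          (hτ 0).integral_inner_add_sq_le (memLp_sum_sub fun i => hτ (Fin.succ i))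
            (memLp_pairInner_sub fun i => hτ (Fin.succ i))
      _ ≤ lam * (n * (lam * Module.finrank ℝ E)) + n ^ 2 * (lam ^ 2 * Module.finrank ℝ E) := by
          gcongr
          · exact integral_norm_sum_sub_sq_le fun i => hτ i.succ
          · exact ih fun i => hτ i.succ
      _ ≤ _ := by
          have : 0 ≤ (n + 1) * (lam ^ 2 * Module.finrank ℝ E) := by positivity
          push_cast
          linarith

theorem memLp_pairInner (hτ : ∀ i, HasMeanCovLE θ lam (τ i)) :
    MemLp (fun u : Fin n → E => pairInner u) 2 (Measure.pi τ) := by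
  have := fun i => (hτ i).isProbabilityMeasure
  have linear : MemLp (fun u : Fin n → E => (n - 1 : ℝ) * inner ℝ (∑ i, (u i - θ)) θ) 2
      (Measure.pi τ) := ((memLp_sum_sub hτ).inner_const θ).const_mul _
  have constant : MemLp (fun _ : Fin n → E => (n : ℝ) * (n - 1) / 2 * ‖θ‖ ^ 2) 2 (Measure.pi τ) :=
    memLp_const _
  have centered := funext fun u : Fin n → E => pairInner_eq_centered θ u
  rw [centered]
  exact (constant.add linear).add (memLp_pairInner_sub hτ)

theorem integral_pairInner_sub_mean_sq_le (hlam : 0 ≤ lam)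
    (hτ : ∀ i, HasMeanCovLE θ lam (τ i)) :
    ∫ u : Fin n → E, (pairInner u - (n : ℝ) * (n - 1) / 2 * ‖θ‖ ^ 2) ^ 2 ∂Measure.pi τ ≤
      2 * n ^ 3 * (lam * ‖θ‖ ^ 2) + 2 * n ^ 2 * (lam ^ 2 * Module.finrank ℝ E) := by
  have := fun i => (hτ i).isProbabilityMeasure
  have linear_sq : Integrable
      (fun u : Fin n → E => 2 * (n - 1 : ℝ) ^ 2 * inner ℝ (∑ i, (u i - θ)) θ ^ 2) (Measure.pi τ) :=
    ((memLp_sum_sub hτ).inner_const θ).integrable_sq.const_mul _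
  have pairs_sq : Integrable (fun u : Fin n → E => 2 * (pairInner fun i => u i - θ) ^ 2)
      (Measure.pi τ) := (memLp_pairInner_sub hτ).integrable_sq.const_mul _
  calc _ ≤ ∫ u : Fin n → E, (2 * (n - 1 : ℝ) ^ 2 * inner ℝ (∑ i, (u i - θ)) θ ^ 2 +
          2 * (pairInner fun i => u i - θ) ^ 2) ∂Measure.pi τ := by
        refine integral_mono ((memLp_pairInner hτ).sub (memLp_const _)).integrable_sq
          (linear_sq.add pairs_sq) fun u => ?_
        simp only
        rw [pairInner_eq_centered θ u]
        nlinarith [sq_nonneg ((n - 1 : ℝ) * inner ℝ (∑ i, (u i - θ)) θ -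
          pairInner fun i => u i - θ)]
    _ = 2 * (n - 1 : ℝ) ^ 2 * ∫ u : Fin n → E, inner ℝ (∑ i, (u i - θ)) θ ^ 2 ∂Measure.pi τ +
          2 * ∫ u : Fin n → E, (pairInner fun i => u i - θ) ^ 2 ∂Measure.pi τ := by
        rw [integral_add linear_sq pairs_sq, integral_const_mul, integral_const_mul]
    _ ≤ 2 * (n - 1 : ℝ) ^ 2 * (n * (lam * ‖θ‖ ^ 2)) +
          2 * (n ^ 2 * (lam ^ 2 * Module.finrank ℝ E)) := by
        gcongr
        · exact integral_inner_sum_sub_sq_le hτ θ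
        · exact integral_pairInner_sub_sq_le hlam hτ
    _ ≤ _ := by
        have : 2 * (n - 1 : ℝ) ^ 2 * n ≤ 2 * n ^ 3 := by
          rcases n.eq_zero_or_pos with rfl | hn
          · simp
          · have : (1 : ℝ) ≤ n := by exact_mod_cast hn
            nlinarith
        have := mul_le_mul_of_nonneg_right this (show 0 ≤ lam * ‖θ‖ ^ 2 by positivity)
        linarith

end UStatistic

section RegressionVector

theorem isStandardized_gaussianReal :
    IsStandardized (∫ x, x ^ 4 ∂gaussianReal 0 1) (gaussianReal 0 1) where
  isProbabilityMeasure := inferInstance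
  memLp := memLp_id_gaussianReal 4
  mean := integral_id_gaussianReal
  second_moment := by
    rw [← variance_of_integral_eq_zero (by fun_prop) integral_id_gaussianReal]
    exact variance_id_gaussianReal
  fourth_moment_le := le_rfl

/-- The summand `Y • x` of the U-statistic, `Y = ⟪θ, x⟫ + ξ` being the response to the row `x` of
the design; the argument is the pair `z = (ξ, x)`. -/
noncomputable def regressionVector {p : ℕ} (θ : EuclideanSpace ℝ (Fin p)) (z : ℝ × (Fin p → ℝ)) :
    EuclideanSpace ℝ (Fin p) :=
  (∑ j, θ j * z.2 j + z.1) • WithLp.toLp 2 z.2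

variable {p : ℕ} {C : ℝ} {ν : Fin p → Measure ℝ}

@[fun_prop]
theorem measurable_regressionVector (θ : EuclideanSpace ℝ (Fin p)) :
    Measurable (regressionVector θ) := by
  unfold regressionVector
  fun_prop

theorem inner_regressionVector (θ v : EuclideanSpace ℝ (Fin p)) (z : ℝ × (Fin p → ℝ)) :
    inner ℝ (regressionVector θ z) v =
      z.1 * ∑ j, v j * z.2 j + (∑ j, θ j * z.2 j) * ∑ j, v j * z.2 j := by
  rw [regressionVector, real_inner_smul_left, PiLp.inner_apply]
  simp only [Real.inner_apply, mul_comm (z.2 _) (v _)]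
  ring

theorem integral_sum_mul_mul_sum_mul_sq_le (hν : ∀ j, IsStandardized C (ν j)) (hC : 0 ≤ C)
    (v w : EuclideanSpace ℝ (Fin p)) :
    ∫ x : Fin p → ℝ, ((∑ j, v j * x j) * ∑ j, w j * x j) ^ 2 ∂Measure.pi ν ≤
      4 * C * ‖v‖ ^ 2 * ‖w‖ ^ 2 := by
  have fourth_moment (u : EuclideanSpace ℝ (Fin p)) :
      ∫ x : Fin p → ℝ, ((∑ j, u j * x j) ^ 2) ^ 2 ∂Measure.pi ν ≤
        (√(4 * C) * ‖u‖ ^ 2) ^ 2 := by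
    simp only [← pow_mul, mul_pow, Real.sq_sqrt (show 0 ≤ 4 * C by positivity)]
    refine (integral_sum_mul_pow_four_le hν u).trans_eq ?_
    rw [← EuclideanSpace.real_norm_sq_eq]
    ring
  simp only [mul_pow]
  refine (integral_mul_le_of_integral_sq_le (memLp_sq (memLp_sum_mul hν v))
    (memLp_sq (memLp_sum_mul hν w)) (by positivity) (by positivity) (fourth_moment v)
    (fourth_moment w)).trans_eq ?_
  linear_combination (‖v‖ ^ 2 * ‖w‖ ^ 2) * Real.sq_sqrt (show 0 ≤ 4 * C by positivity)

theorem memLp_inner_regressionVector (hν : ∀ j, IsStandardized C (ν j))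
    (θ v : EuclideanSpace ℝ (Fin p)) :
    MemLp (fun z => inner ℝ (regressionVector θ z) v) 2
      ((gaussianReal 0 1).prod (Measure.pi ν)) := by
  have := fun j => (hν j).isProbabilityMeasure
  simp only [inner_regressionVector]
  exact ((memLp_mul_prod isStandardized_gaussianReal.memLp (memLp_sum_mul hν v)).mono_exponent
    (by norm_num)).add
    ((memLp_mul_of_memLp_four (memLp_sum_mul hν θ) (memLp_sum_mul hν v)).comp_snd _)

theorem integral_inner_regressionVector (hν : ∀ j, IsStandardized C (ν j))
    (θ v : EuclideanSpace ℝ (Fin p)) :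
    ∫ z, inner ℝ (regressionVector θ z) v ∂(gaussianReal 0 1).prod (Measure.pi ν) =
      inner ℝ θ v := by
  have := fun j => (hν j).isProbabilityMeasure
  simp only [inner_regressionVector]
  rw [isStandardized_gaussianReal.integral_mul_add (f := fun x : Fin p → ℝ => ∑ j, v j * x j)
    (g := fun x : Fin p → ℝ => (∑ j, θ j * x j) * ∑ j, v j * x j)
    ((memLp_sum_mul hν v).integrable (by norm_num))
    ((memLp_mul_of_memLp_four (memLp_sum_mul hν θ) (memLp_sum_mul hν v)).integrable (by norm_num)),
    integral_sum_mul_mul_sum_mul hν, PiLp.inner_apply]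
  simp only [Real.inner_apply]

theorem integral_inner_regressionVector_sq_le (hν : ∀ j, IsStandardized C (ν j)) (hC : 0 ≤ C)
    (θ v : EuclideanSpace ℝ (Fin p)) :
    ∫ z, inner ℝ (regressionVector θ z) v ^ 2 ∂(gaussianReal 0 1).prod (Measure.pi ν) ≤
      (1 + 4 * C * ‖θ‖ ^ 2) * ‖v‖ ^ 2 := by
  have := fun j => (hν j).isProbabilityMeasure
  have hv : MemLp (fun x : Fin p → ℝ => ∑ j, v j * x j) 2 (Measure.pi ν) :=
    (memLp_sum_mul hν v).mono_exponent (by norm_num)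
  have hθv := memLp_mul_of_memLp_four (memLp_sum_mul hν θ) (memLp_sum_mul hν v)
  simp only [inner_regressionVector, sq (_ + _)]
  rw [isStandardized_gaussianReal.integral_mul_add_mul_mul_add hv hθv hv hθv]
  simp only [← sq]
  rw [integral_sum_mul_sq hν, ← EuclideanSpace.real_norm_sq_eq]
  linarith [integral_sum_mul_mul_sum_mul_sq_le hν hC θ v]

theorem hasMeanCovLE_regressionVector (hν : ∀ j, IsStandardized C (ν j)) (hC : 0 ≤ C)
    (θ : EuclideanSpace ℝ (Fin p)) :
    HasMeanCovLE θ (1 + 4 * C * ‖θ‖ ^ 2)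
      (((gaussianReal 0 1).prod (Measure.pi ν)).map (regressionVector θ)) := by
  have := fun j => (hν j).isProbabilityMeasure
  have hR := (measurable_regressionVector θ).aemeasurable
    (μ := (gaussianReal 0 1).prod (Measure.pi ν))
  have hmem : MemLp (regressionVector θ) 2 ((gaussianReal 0 1).prod (Measure.pi ν)) := by
    refine MemLp.of_eval_piLp fun j => ?_
    simpa [EuclideanSpace.inner_single_right] using
      memLp_inner_regressionVector hν θ (EuclideanSpace.single j 1)
  refine ⟨Measure.isProbabilityMeasure_map hR, ?_, ?_, fun v => ?_⟩
  · exact (memLp_map_measure_iff aestronglyMeasurable_id hR).2 hmem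
  · rw [integral_map hR (by fun_prop)]
    refine ext_inner_right ℝ fun v => ?_
    rw [real_inner_comm, ← integral_inner (hmem.integrable (by norm_num)),
      ← integral_inner_regressionVector hν θ v]
    simp only [real_inner_comm v]
  · rw [variance_map (by fun_prop) hR]
    exact (variance_le_expectation_sq (memLp_inner_regressionVector hν θ v).1).trans
      (integral_inner_regressionVector_sq_le hν hC θ v)

theorem measurePreserving_regressionVector {n : ℕ} {ρ : Fin n → Measure (Fin p → ℝ)}
    [∀ i, IsProbabilityMeasure (ρ i)] (θ : EuclideanSpace ℝ (Fin p)) :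
    MeasurePreserving
      (fun (w : (Fin n → Fin p → ℝ) × (Fin n → ℝ)) i => regressionVector θ (w.2 i, w.1 i))
      ((Measure.pi ρ).prod (Measure.pi fun _ => gaussianReal 0 1))
      (Measure.pi fun i => ((gaussianReal 0 1).prod (ρ i)).map (regressionVector θ)) := by
  have zip := measurePreserving_arrowProdEquivProdArrow ℝ (Fin p → ℝ) (Fin n)
    (fun _ => gaussianReal 0 1) ρ
  have := fun i => Measure.isProbabilityMeasure_map (μ := (gaussianReal 0 1).prod (ρ i))
    (measurable_regressionVector θ).aemeasurable
  exact ((measurePreserving_pi _ _ fun i =>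
    (measurable_regressionVector θ).measurePreserving ((gaussianReal 0 1).prod (ρ i))).comp
      (zip.symm _)).comp Measure.measurePreserving_swap

end RegressionVector

section TypeTwo

variable {n p : ℕ}

theorem measurable_statT1 : Measurable (statT1 : Obs n p → ℝ) := by
  unfold statT1 kernelK
  fun_prop

theorem measurable_prodMk_response (θ : EuclideanSpace ℝ (Fin p)) :
    Measurable fun w : Design n p × (Fin n → ℝ) => (w.1, response θ w.1 w.2) := by
  unfold response
  fun_prop

theorem statT1_response (θ : EuclideanSpace ℝ (Fin p)) (w : Design n p × (Fin n → ℝ)) :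
    statT1 (w.1, response θ w.1 w.2) = (√((n : ℝ) * (n - 1) / 2))⁻¹ *
      ((√p)⁻¹ * pairInner fun i => regressionVector θ (w.2 i, w.1 i)) := by
  unfold statT1 kernelK pairInner
  rw [← Finset.mul_sum]
  congr 2
  refine Finset.sum_congr rfl fun q _ => ?_
  simp only [regressionVector, response, real_inner_smul_left, real_inner_smul_right]
  simp only [PiLp.inner_apply, Real.inner_apply]
  ring

theorem typeIIErrorAt_eq_measureReal (PX : Measure (Design n p)) [IsProbabilityMeasure PX] (α : ℝ)
    (θ : EuclideanSpace ℝ (Fin p)) :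
    typeIIErrorAt PX (testPsi1 n p α) θ =
      (PX.prod (Measure.pi fun _ => gaussianReal 0 1)).real
        {w | statT1 (w.1, response θ w.1 w.2) ≤ gaussianUpperQuantile α} := by
  have accept := measurableSet_le (measurable_statT1 (n := n) (p := p))
    (measurable_const (a := gaussianUpperQuantile α))
  have indicator_eq : (fun Z : Obs n p => 1 - testPsi1 n p α Z) =
      Set.indicator {Z | statT1 Z ≤ gaussianUpperQuantile α} 1 := by
    ext Z
    by_cases h : statT1 Z ≤ gaussianUpperQuantile α
    · simp [testPsi1, h]
    · simp [testPsi1, h, not_le.1 h]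
  rw [typeIIErrorAt, indicator_eq, integral_indicator_one accept, modelLaw,
    map_measureReal_apply (measurable_prodMk_response θ) accept]
  rfl

theorem sq_div_four_le_choose_two (hn : 2 ≤ n) : (n : ℝ) ^ 2 / 4 ≤ (n : ℝ) * (n - 1) / 2 := by
  have : (2 : ℝ) ≤ n := by exact_mod_cast hn
  nlinarith

section Chebyshev

variable {C : ℝ} {ν : Fin n → Fin p → Measure ℝ}

theorem measureReal_pairInner_regressionVector_le (hν : ∀ i j, IsStandardized C (ν i j))
    (hC : 0 ≤ C) (θ : EuclideanSpace ℝ (Fin p)) {ε : ℝ} (hε : 0 < ε) :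
    ((Measure.pi fun i => Measure.pi (ν i)).prod (Measure.pi fun _ => gaussianReal 0 1)).real
        {w | ε ≤ ((pairInner fun i => regressionVector θ (w.2 i, w.1 i)) -
          (n : ℝ) * (n - 1) / 2 * ‖θ‖ ^ 2) ^ 2} ≤
      (2 * n ^ 3 * ((1 + 4 * C * ‖θ‖ ^ 2) * ‖θ‖ ^ 2) +
        2 * n ^ 2 * ((1 + 4 * C * ‖θ‖ ^ 2) ^ 2 * p)) / ε := by
  have := fun i j => (hν i j).isProbabilityMeasure
  have hτ := fun i => hasMeanCovLE_regressionVector (hν i) hC θ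
  have := fun i => (hτ i).isProbabilityMeasure
  have transfer := measurePreserving_regressionVector (ρ := fun i => Measure.pi (ν i)) θ
  have hsq := ((memLp_pairInner hτ).sub
    (memLp_const ((n : ℝ) * (n - 1) / 2 * ‖θ‖ ^ 2))).integrable_sq
  have variance_le := integral_pairInner_sub_mean_sq_le (by positivity) hτ
  rw [finrank_euclideanSpace_fin, ← transfer.map_eq, integral_map transfer.aemeasurable
    (transfer.map_eq ▸ hsq.1)] at variance_le
  rw [le_div_iff₀' hε]
  exact (mul_meas_ge_le_integral_of_nonneg (ae_of_all _ fun w => sq_nonneg _)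
    (transfer.integrable_comp_of_integrable hsq) ε).trans variance_le

theorem sq_le_sq_pairInner_sub_of_statT1_le (hn : 2 ≤ n) (hp : 1 ≤ p) {r u : ℝ} (hr : 0 < r)
    (hu : 4 * u ≤ n * r ^ 2 / √p) {θ : EuclideanSpace ℝ (Fin p)} (hθ : r ≤ ‖θ‖)
    {w : Design n p × (Fin n → ℝ)} (hw : statT1 (w.1, response θ w.1 w.2) ≤ u) :
    (n ^ 2 / 8 * ‖θ‖ ^ 2) ^ 2 ≤ ((pairInner fun i => regressionVector θ (w.2 i, w.1 i)) -
      (n : ℝ) * (n - 1) / 2 * ‖θ‖ ^ 2) ^ 2 := by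
  rw [statT1_response] at hw
  have hN := sq_div_four_le_choose_two hn
  set N := (n : ℝ) * (n - 1) / 2
  set P := pairInner fun i => regressionVector θ (w.2 i, w.1 i)
  have hn' : (2 : ℝ) ≤ n := by exact_mod_cast hn
  have hp' : (1 : ℝ) ≤ p := by exact_mod_cast hp
  have sqrt_p_pos : 0 < √p := Real.sqrt_pos.2 (by linarith)
  have sqrt_N_ge : (n : ℝ) / 2 ≤ √N := Real.le_sqrt_of_sq_le (by linarith)
  have sqrt_N_sq : √N ^ 2 = N := Real.sq_sqrt (by nlinarith)
  have P_le : P ≤ N * ‖θ‖ ^ 2 / 2 := by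
    rw [inv_mul_le_iff₀ (by linarith), inv_mul_le_iff₀ sqrt_p_pos] at hw
    calc P ≤ √p * (√N * u) := hw
      _ = √N * (√p * (4 * u)) / 4 := by ring
      _ ≤ √N * (√p * (n * r ^ 2 / √p)) / 4 := by gcongr
      _ = √N * (n / 2 * r ^ 2) / 2 := by field_simp; norm_num
      _ ≤ √N * (√N * ‖θ‖ ^ 2) / 2 := by gcongr
      _ = N * ‖θ‖ ^ 2 / 2 := by rw [← mul_assoc, ← sq, sqrt_N_sq]
  have mean_ge := mul_le_mul_of_nonneg_right hN (sq_nonneg ‖θ‖)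
  rw [← neg_sub, neg_sq]
  exact pow_le_pow_left₀ (by positivity) (by linarith) 2

theorem typeIIErrorAt_le (hν : ∀ i j, IsStandardized C (ν i j)) (hC : 0 ≤ C) (hn : 2 ≤ n)
    (hp : 1 ≤ p) {α r : ℝ} (hr : 0 < r) (hu : 4 * gaussianUpperQuantile α ≤ n * r ^ 2 / √p)
    {θ : EuclideanSpace ℝ (Fin p)} (hθ : r ≤ ‖θ‖) :
    typeIIErrorAt (Measure.pi fun i => Measure.pi (ν i)) (testPsi1 n p α) θ ≤
      128 * ((4 * C * (√p / n) + (n * r ^ 2 / √p)⁻¹) +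
        (4 * C * (√p / n) + (n * r ^ 2 / √p)⁻¹) ^ 2) := by
  have := fun i j => (hν i j).isProbabilityMeasure
  have : (0 : ℝ) < n := by exact_mod_cast (by omega : 0 < n)
  have hp' : (1 : ℝ) ≤ √p := Real.one_le_sqrt.2 (by exact_mod_cast hp)
  have hθ₀ : 0 < ‖θ‖ := hr.trans_le hθ
  set A := 4 * C + (r ^ 2)⁻¹
  have cov_le : 1 + 4 * C * ‖θ‖ ^ 2 ≤ A * ‖θ‖ ^ 2 := by
    have : 1 ≤ (r ^ 2)⁻¹ * ‖θ‖ ^ 2 := by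
      rw [inv_mul_eq_div, one_le_div (by positivity)]
      gcongr
    linarith
  have radius_eq : 4 * C * (√p / n) + (n * r ^ 2 / √p)⁻¹ = A / n * √p := by
    simp only [A, inv_div]
    field_simp
  have deviation_le := measureReal_pairInner_regressionVector_le hν hC θ
    (show 0 < ((n : ℝ) ^ 2 / 8 * ‖θ‖ ^ 2) ^ 2 by positivity)
  rw [typeIIErrorAt_eq_measureReal, radius_eq]
  refine (measureReal_mono fun w hw =>
    sq_le_sq_pairInner_sub_of_statT1_le hn hp hr hu hθ hw).trans (deviation_le.trans ?_)
  calc _ ≤ (2 * (n : ℝ) ^ 3 * (A * ‖θ‖ ^ 2 * ‖θ‖ ^ 2) +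
          2 * (n : ℝ) ^ 2 * ((A * ‖θ‖ ^ 2) ^ 2 * √p ^ 2)) / ((n : ℝ) ^ 2 / 8 * ‖θ‖ ^ 2) ^ 2 := by
        rw [Real.sq_sqrt (Nat.cast_nonneg p)]
        gcongr
    _ = 128 * (A / n * 1 + (A / n * √p) ^ 2) := by
        field_simp
        ring
    _ ≤ 128 * (A / n * √p + (A / n * √p) ^ 2) := by gcongr

end Chebyshev

theorem typeIIError_nonneg (PX : Measure (Design n p)) [IsProbabilityMeasure PX] (α : ℝ)
    (Θ : Set (EuclideanSpace ℝ (Fin p))) : 0 ≤ typeIIError PX (testPsi1 n p α) Θ :=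
  Real.iSup_nonneg fun θ => typeIIErrorAt_eq_measureReal PX α θ ▸ measureReal_nonneg

end TypeTwo

theorem tendsto_typeIIError_of_isStandardized {ι : Type*} {l : Filter ι} {n p : ι → ℕ} {C : ℝ}
    (hC : 0 ≤ C) {PX : ∀ m, Measure (Design (n m) (p m))} [∀ m, IsProbabilityMeasure (PX m)]
    (hPX : ∀ᶠ m in l, 2 ≤ n m ∧ 2 ≤ p m ∧ ∃ ν : Fin (n m) → Fin (p m) → Measure ℝ,
      (∀ i j, IsStandardized C (ν i j)) ∧ PX m = Measure.pi fun i => Measure.pi (ν i)) {α : ℝ}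
    (hpn : (fun m => (p m : ℝ)) =o[l] (fun m => (n m : ℝ) ^ 2)) {r : ι → ℝ} (hr₀ : ∀ m, 0 < r m)
    (hr : Tendsto (fun m => (n m : ℝ) * r m ^ 2 / √(p m)) l atTop) :
    Tendsto (fun m => typeIIError (PX m) (testPsi1 (n m) (p m) α) (alternative (p m) (r m))) l
      (𝓝 0) := by
  have sqrt_div : Tendsto (fun m => √(p m) / n m) l (𝓝 0) := by
    simpa using hpn.tendsto_div_nhds_zero.sqrt
  have radius : Tendsto (fun m => 4 * C * (√(p m) / n m) +
      ((n m : ℝ) * r m ^ 2 / √(p m))⁻¹) l (𝓝 0) := by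
    simpa using (sqrt_div.const_mul (4 * C)).add hr.inv_tendsto_atTop
  have bound := (radius.add (radius.pow 2)).const_mul 128
  rw [zero_pow two_ne_zero, add_zero, mul_zero] at bound
  refine squeeze_zero' (Eventually.of_forall fun m => typeIIError_nonneg (PX m) α _) ?_ bound
  filter_upwards [hPX, hr.eventually_ge_atTop (4 * gaussianUpperQuantile α)] with m hm hrm
  obtain ⟨hnm, hpm, ν, hν, hPXm⟩ := hm
  refine Real.iSup_le (fun θ => ?_) (by positivity)
  rw [hPXm]
  exact typeIIErrorAt_le hν hC hnm (by omega) (hr₀ m) hrm θ.2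

section CharFun

theorem norm_exp_mul_I_sub_quadratic_le (x : ℝ) :
    ‖Complex.exp (x * Complex.I) - (1 + x * Complex.I - (x ^ 2 / 2 : ℝ))‖ ≤ 4 * |x| ^ 3 := by
  have norm_arg : ‖(x : ℂ) * Complex.I‖ = |x| := by simp
  rcases le_total |x| 1 with h | h
  · have taylor := Complex.norm_exp_sub_sum_le_norm_mul_exp (x * Complex.I) 3
    have sum_eq : ∑ k ∈ Finset.range 3, ((x : ℂ) * Complex.I) ^ k / k.factorial =
        1 + x * Complex.I - (x ^ 2 / 2 : ℝ) := by
      simp only [Finset.sum_range_succ, Finset.sum_range_zero, mul_pow, Complex.I_sq]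
      norm_num
      ring
    rw [sum_eq, norm_arg] at taylor
    have exp_le : Real.exp |x| ≤ 4 :=
      (Real.exp_le_exp.2 h).trans (by linarith [Real.exp_one_lt_d9])
    nlinarith [pow_nonneg (abs_nonneg x) 3]
  · have norm_sq_div : ‖((x ^ 2 / 2 : ℝ) : ℂ)‖ = |x| ^ 2 / 2 := by simp
    calc _ ≤ ‖Complex.exp (x * Complex.I)‖ +
            ((‖(1 : ℂ)‖ + ‖(x : ℂ) * Complex.I‖) + ‖((x ^ 2 / 2 : ℝ) : ℂ)‖) :=
          (norm_sub_le _ _).trans (by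
            gcongr
            exact (norm_sub_le _ _).trans (by gcongr; exact norm_add_le _ _))
      _ = 2 + |x| + |x| ^ 2 / 2 := by
          rw [Complex.norm_exp_ofReal_mul_I, norm_one, norm_arg, norm_sq_div]
          ring
      _ ≤ 4 * |x| ^ 3 := by
          nlinarith [one_le_pow₀ h (n := 3), le_self_pow₀ h (n := 3) (by norm_num),
            pow_le_pow_right₀ h (show 2 ≤ 3 by norm_num)]

theorem abs_exp_neg_sq_div_two_sub_le {y : ℝ} (hy : 0 ≤ y) :
    |Real.exp (-(y ^ 2 / 2)) - (1 - y ^ 2 / 2)| ≤ y ^ 3 := by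
  rcases le_total y 1 with h | h
  · have taylor := Real.abs_exp_sub_one_sub_id_le (x := -(y ^ 2 / 2))
      (by rw [abs_neg, abs_of_nonneg (by positivity)]; nlinarith)
    rw [sub_sub, ← sub_eq_add_neg] at taylor
    nlinarith [pow_le_pow_of_le_one hy h (show 3 ≤ 4 by norm_num), pow_nonneg hy 4]
  · rw [abs_of_nonneg (by linarith [Real.one_sub_le_exp_neg (y ^ 2 / 2)])]
    have := Real.exp_le_one_iff.2 (show -(y ^ 2 / 2) ≤ 0 by nlinarith)
    nlinarith

theorem abs_exp_neg_sub_exp_neg_le {a b : ℝ} (ha : 0 ≤ a) (hb : 0 ≤ b) :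
    |Real.exp (-a) - Real.exp (-b)| ≤ |a - b| := by
  wlog hab : a ≤ b generalizing a b
  · rw [abs_sub_comm, abs_sub_comm a]
    exact this hb ha (le_of_not_ge hab)
  rw [abs_of_nonneg (sub_nonneg.2 (Real.exp_le_exp.2 (neg_le_neg hab))),
    abs_of_nonpos (by linarith)]
  calc Real.exp (-a) - Real.exp (-b) = Real.exp (-a) * (1 - Real.exp (-(b - a))) := by
        rw [mul_sub, ← Real.exp_add]
        ring_nf
    _ ≤ 1 * (b - a) := by
        refine mul_le_mul (Real.exp_le_one_iff.2 (neg_nonpos.2 ha)) ?_ ?_ zero_le_one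
        · linarith [Real.one_sub_le_exp_neg (b - a)]
        · exact sub_nonneg.2 (Real.exp_le_one_iff.2 (by linarith))
    _ = -(a - b) := by ring

theorem norm_prod_sub_prod_le {κ R : Type*} [NormedCommRing R] [NormOneClass R] (s : Finset κ)
    {a b : κ → R} (ha : ∀ i, ‖a i‖ ≤ 1) (hb : ∀ i, ‖b i‖ ≤ 1) :
    ‖∏ i ∈ s, a i - ∏ i ∈ s, b i‖ ≤ ∑ i ∈ s, ‖a i - b i‖ := by
  classical
  induction s using Finset.induction_on with
  | empty => simp
  | insert i s hi ih =>
    rw [Finset.prod_insert hi, Finset.prod_insert hi, Finset.sum_insert hi]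
    have prod_le : ‖∏ j ∈ s, a j‖ ≤ 1 :=
      (Finset.norm_prod_le s a).trans <|
        Finset.prod_le_one (fun _ _ => norm_nonneg _) fun j _ => ha j
    calc ‖a i * ∏ j ∈ s, a j - b i * ∏ j ∈ s, b j‖
        = ‖(a i - b i) * ∏ j ∈ s, a j + b i * (∏ j ∈ s, a j - ∏ j ∈ s, b j)‖ := by ring_nf
      _ ≤ ‖a i - b i‖ * ‖∏ j ∈ s, a j‖ + ‖b i‖ * ‖∏ j ∈ s, a j - ∏ j ∈ s, b j‖ :=
          norm_add_le_of_le (norm_mul_le _ _) (norm_mul_le _ _)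
      _ ≤ ‖a i - b i‖ * 1 + 1 * ∑ j ∈ s, ‖a j - b j‖ := by
          gcongr
          exact hb i
      _ = _ := by ring

variable {Ω : Type*} [MeasurableSpace Ω] {P : Measure Ω} {Z : Ω → ℝ}

theorem charFun_map_eq_integral (hZ : AEMeasurable Z P) (t : ℝ) :
    charFun (P.map Z) t = ∫ ω, Complex.exp ((t * Z ω : ℝ) * Complex.I) ∂P := by
  rw [charFun_apply_real, integral_map hZ (by fun_prop)]
  simp only [Complex.ofReal_mul]

variable [IsProbabilityMeasure P]

theorem sqrt_integral_sq_pow_three_le (hZ : MemLp Z 3 P) :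
    √(∫ ω, Z ω ^ 2 ∂P) ^ 3 ≤ ∫ ω, |Z ω| ^ 3 ∂P := by
  have h₂ : Integrable (fun ω => Z ω ^ 2) P := (hZ.mono_exponent (by norm_num)).integrable_sq
  have h₃ : Integrable (fun ω => |Z ω| ^ 3) P := by simpa using hZ.integrable_norm_pow (by norm_num)
  set a := √(∫ ω, Z ω ^ 2 ∂P)
  have a_sq : a ^ 2 = ∫ ω, Z ω ^ 2 ∂P := Real.sq_sqrt (integral_nonneg fun _ => sq_nonneg _)
  have am_gm (y : ℝ) : 3 * a * y ^ 2 ≤ 2 * |y| ^ 3 + a ^ 3 := by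
    have ha : 0 ≤ a := Real.sqrt_nonneg _
    rw [← sq_abs]
    nlinarith [mul_nonneg (add_nonneg (abs_nonneg y) ha) (sq_nonneg (|y| - a)),
      mul_nonneg (abs_nonneg y) (sq_nonneg (|y| - a))]
  have := integral_mono (h₂.const_mul (3 * a)) ((h₃.const_mul 2).add (integrable_const (a ^ 3)))
    fun ω => am_gm (Z ω)
  simp only [Pi.add_apply] at this
  rw [integral_const_mul, integral_add (h₃.const_mul 2) (integrable_const _), integral_const_mul,
    ← a_sq] at this
  simp only [integral_const, probReal_univ, one_smul] at this
  nlinarith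

theorem norm_charFun_sub_quadratic_le (hZ : MemLp Z 3 P) (hmean : ∫ ω, Z ω ∂P = 0) (t : ℝ) :
    ‖charFun (P.map Z) t - ((1 - (∫ ω, Z ω ^ 2 ∂P) * t ^ 2 / 2 : ℝ) : ℂ)‖ ≤
      4 * |t| ^ 3 * ∫ ω, |Z ω| ^ 3 ∂P := by
  have h₁ : Integrable (fun ω => ((t * Z ω : ℝ) : ℂ) * Complex.I) P :=
    (((hZ.integrable (by norm_num)).const_mul t).ofReal).mul_const _
  have h₂ : Integrable (fun ω => (((t * Z ω) ^ 2 / 2 : ℝ) : ℂ)) P :=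
    (((hZ.mono_exponent (by norm_num)).const_mul t).integrable_sq.div_const 2).ofReal
  have h₃ : Integrable (fun ω => |Z ω| ^ 3) P := by simpa using hZ.integrable_norm_pow (by norm_num)
  have hexp : Integrable (fun ω => Complex.exp ((t * Z ω : ℝ) * Complex.I)) P :=
    Integrable.of_bound (by have := hZ.1; fun_prop) 1
      (ae_of_all _ fun ω => (Complex.norm_exp_ofReal_mul_I _).le)
  have integral_quadratic : ∫ ω, (1 + (t * Z ω : ℝ) * Complex.I - ((t * Z ω) ^ 2 / 2 : ℝ)) ∂P =
      ((1 - (∫ ω, Z ω ^ 2 ∂P) * t ^ 2 / 2 : ℝ) : ℂ) := by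
    rw [integral_sub (by exact (integrable_const 1).add h₁) h₂,
      integral_add (integrable_const _) h₁, integral_mul_const, integral_complex_ofReal,
      integral_const_mul, hmean, integral_complex_ofReal, integral_div]
    simp only [mul_pow, integral_const_mul, integral_const, probReal_univ, one_smul, mul_zero,
      Complex.ofReal_zero, zero_mul, add_zero]
    push_cast
    ring
  rw [charFun_map_eq_integral hZ.1.aemeasurable, ← integral_quadratic,
    ← integral_sub hexp (by exact ((integrable_const 1).add h₁).sub h₂), ← integral_const_mul]
  refine norm_integral_le_of_norm_le (h₃.const_mul _) (ae_of_all _ fun ω => ?_)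
  refine (norm_exp_mul_I_sub_quadratic_le (t * Z ω)).trans_eq ?_
  rw [abs_mul, mul_pow, mul_assoc]

theorem norm_charFun_sub_exp_le (hZ : MemLp Z 3 P) (hmean : ∫ ω, Z ω ∂P = 0) (t : ℝ) :
    ‖charFun (P.map Z) t - (Real.exp (-((∫ ω, Z ω ^ 2 ∂P) * t ^ 2 / 2)) : ℂ)‖ ≤
      5 * |t| ^ 3 * ∫ ω, |Z ω| ^ 3 ∂P := by
  set v := ∫ ω, Z ω ^ 2 ∂P
  have exp_sub : |Real.exp (-(v * t ^ 2 / 2)) - (1 - v * t ^ 2 / 2)| ≤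
      |t| ^ 3 * ∫ ω, |Z ω| ^ 3 ∂P := by
    have := abs_exp_neg_sq_div_two_sub_le (mul_nonneg (Real.sqrt_nonneg v) (abs_nonneg t))
    rw [mul_pow, sq_abs, Real.sq_sqrt (integral_nonneg fun _ => sq_nonneg _), mul_pow,
      mul_comm _ (|t| ^ 3)] at this
    exact this.trans (by gcongr; exact sqrt_integral_sq_pow_three_le hZ)
  calc _ ≤ ‖charFun (P.map Z) t - ((1 - v * t ^ 2 / 2 : ℝ) : ℂ)‖ +
        ‖((1 - v * t ^ 2 / 2 : ℝ) : ℂ) - (Real.exp (-(v * t ^ 2 / 2)) : ℂ)‖ :=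
          norm_sub_le_norm_sub_add_norm_sub _ _ _
    _ ≤ 4 * |t| ^ 3 * ∫ ω, |Z ω| ^ 3 ∂P + |t| ^ 3 * ∫ ω, |Z ω| ^ 3 ∂P := by
        rw [← Complex.ofReal_sub, Complex.norm_real, Real.norm_eq_abs, abs_sub_comm (1 - _)]
        exact add_le_add (norm_charFun_sub_quadratic_le hZ hmean t) exp_sub
    _ = _ := by ring

theorem norm_charFun_sum_sub_exp_le {κ : Type*} [Fintype κ] {Z : κ → Ω → ℝ} (hindep : iIndepFun Z P)
    (hZ : ∀ j, MemLp (Z j) 3 P) (hmean : ∀ j, ∫ ω, Z j ω ∂P = 0) (t : ℝ) :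
    ‖charFun (P.map fun ω => ∑ j, Z j ω) t -
        (Real.exp (-((∑ j, ∫ ω, Z j ω ^ 2 ∂P) * t ^ 2 / 2)) : ℂ)‖ ≤
      5 * |t| ^ 3 * ∑ j, ∫ ω, |Z j ω| ^ 3 ∂P := by
  have exp_eq_prod : (Real.exp (-((∑ j, ∫ ω, Z j ω ^ 2 ∂P) * t ^ 2 / 2)) : ℂ) =
      ∏ j, (Real.exp (-((∫ ω, Z j ω ^ 2 ∂P) * t ^ 2 / 2)) : ℂ) := by
    rw [← Complex.ofReal_prod, ← Real.exp_sum, Finset.sum_neg_distrib, Finset.sum_mul,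
      Finset.sum_div]
  rw [hindep.charFun_map_fun_sum_eq_prod fun j => (hZ j).1.aemeasurable, Finset.prod_apply,
    exp_eq_prod, Finset.mul_sum]
  refine (norm_prod_sub_prod_le _ (fun j => ?_) fun j => ?_).trans
    (Finset.sum_le_sum fun j _ => norm_charFun_sub_exp_le (hZ j) (hmean j) t)
  · have := Measure.isProbabilityMeasure_map (hZ j).1.aemeasurable
    exact norm_charFun_le_one (μ := P.map (Z j)) t
  · rw [Complex.norm_real, Real.norm_of_nonneg (Real.exp_nonneg _), Real.exp_le_one_iff,
      neg_nonpos]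
    have : 0 ≤ ∫ ω, Z j ω ^ 2 ∂P := integral_nonneg fun _ => sq_nonneg _
    positivity

theorem norm_charFun_pi_sum_sub_exp_le {κ : Type*} [Fintype κ] {S : κ → Type*}
    [∀ j, MeasurableSpace (S j)] {P : ∀ j, Measure (S j)} [∀ j, IsProbabilityMeasure (P j)]
    {W : ∀ j, S j → ℝ} (hW : ∀ j, MemLp (W j) 3 (P j)) (hmean : ∀ j, ∫ y, W j y ∂P j = 0) (t : ℝ) :
    ‖charFun ((Measure.pi P).map fun x => ∑ j, W j (x j)) t -
        (Real.exp (-((∑ j, ∫ y, W j y ^ 2 ∂P j) * t ^ 2 / 2)) : ℂ)‖ ≤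
      5 * |t| ^ 3 * ∑ j, ∫ y, |W j y| ^ 3 ∂P j := by
  have integral_eval {g : ℝ → ℝ} (hg : Continuous g) (j : κ) :
      ∫ x, g (W j (x j)) ∂Measure.pi P = ∫ y, g (W j y) ∂P j :=
    integral_comp_eval (f := fun y => g (W j y)) (hg.comp_aestronglyMeasurable (hW j).1)
  have := norm_charFun_sum_sub_exp_le (P := Measure.pi P) (Z := fun j x => W j (x j))
    (iIndepFun_pi fun j => (hW j).1.aemeasurable)
    (fun j => (hW j).comp_measurePreserving (measurePreserving_eval P j))
    (fun j => (integral_eval continuous_id j).trans (hmean j)) t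
  simpa only [integral_eval (continuous_pow 2), integral_eval (g := fun x => |x| ^ 3) (by fun_prop)]
    using this

end CharFun

section WeakConvergence

variable {ι E : Type*} {l : Filter ι} [NormedAddCommGroup E] [InnerProductSpace ℝ E]
  [FiniteDimensional ℝ E] [MeasurableSpace E] [BorelSpace E]

/- Lévy's convergence theorem is a statement about sequences. The rate `δ`, uniform over the
arguments `t`, makes it available along a filter that need not be countably generated. -/
theorem tendsto_of_norm_charFun_sub_le {μ : ι → ProbabilityMeasure E} {μ₀ : ProbabilityMeasure E}
    {K : E → ℝ} {δ : ι → ℝ} (hδ : Tendsto δ l (𝓝 0))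
    (h : ∀ᶠ m in l, ∀ t, ‖charFun (μ m : Measure E) t - charFun (μ₀ : Measure E) t‖ ≤ K t * δ m) :
    Tendsto μ l (𝓝 μ₀) := by
  set S := {m | ∀ t, ‖charFun (μ m : Measure E) t - charFun (μ₀ : Measure E) t‖ ≤ K t * δ m}
  suffices Tendsto μ (comap δ (𝓝 0) ⊓ 𝓟 S) (𝓝 μ₀) from
    this.mono_left (le_inf hδ.le_comap (le_principal_iff.2 h))
  refine tendsto_of_seq_tendsto fun m hm =>
    ProbabilityMeasure.tendsto_of_tendsto_charFun fun t => ?_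
  have rate : Tendsto (fun k => K t * δ (m k)) atTop (𝓝 0) := by
    simpa using (tendsto_comap_iff.1 (tendsto_inf.1 hm).1).const_mul (K t)
  rw [tendsto_iff_norm_sub_tendsto_zero]
  refine squeeze_zero' (Eventually.of_forall fun _ => norm_nonneg _) ?_ rate
  filter_upwards [tendsto_principal.1 (tendsto_inf.1 hm).2] with k hk using hk t

theorem tendsto_measureReal_Ioi {μ : ι → ProbabilityMeasure ℝ} {μ₀ : ProbabilityMeasure ℝ}
    [NullSingletonClass (μ₀ : Measure ℝ)] (h : Tendsto μ l (𝓝 μ₀)) (u : ℝ) :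
    Tendsto (fun m => (μ m : Measure ℝ).real (Set.Ioi u)) l
      (𝓝 ((μ₀ : Measure ℝ).real (Set.Ioi u))) := by
  have null_frontier : (μ₀ : Measure ℝ) (frontier (Set.Ioi u)) = 0 := by
    rw [frontier_Ioi, measure_singleton]
  exact (ENNReal.tendsto_toReal (measure_ne_top _ _)).comp
    (ProbabilityMeasure.tendsto_measure_of_null_frontier_of_tendsto' h null_frontier)

end WeakConvergence

section Quantile

variable (μ : Measure ℝ) [IsProbabilityMeasure μ] [NullSingletonClass μ]

theorem continuous_cdf : Continuous (cdf μ) := by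
  refine continuous_iff_continuousAt.2 fun x => ?_
  have jump : ENNReal.ofReal (cdf μ x - Function.leftLim (cdf μ) x) = 0 := by
    rw [← StieltjesFunction.measure_singleton, measure_cdf, measure_singleton]
  rw [(cdf μ).mono.continuousAt_iff_leftLim_eq_rightLim, (cdf μ).rightLim_eq]
  exact le_antisymm ((cdf μ).mono.leftLim_le le_rfl) (sub_nonpos.1 (ENNReal.ofReal_eq_zero.1 jump))

theorem cdf_sInf_setOf_le_cdf {β : ℝ} (hβ : β ∈ Set.Ioo 0 1) :
    cdf μ (sInf {x | β ≤ cdf μ x}) = β := by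
  obtain ⟨a, ha⟩ := ((tendsto_cdf_atBot μ).eventually (eventually_lt_nhds hβ.1)).exists
  obtain ⟨b, hb⟩ := ((tendsto_cdf_atTop μ).eventually (eventually_gt_nhds hβ.2)).exists
  obtain ⟨x, hx⟩ := mem_range_of_exists_le_of_exists_ge (continuous_cdf μ) ⟨a, ha.le⟩ ⟨b, hb.le⟩
  have hbdd : BddBelow {x | β ≤ cdf μ x} :=
    ⟨a, fun y hy => le_of_lt ((cdf μ).mono.reflect_lt (ha.trans_le hy))⟩
  refine le_antisymm ?_
    ((isClosed_le continuous_const (continuous_cdf μ)).csInf_mem ⟨x, hx.ge⟩ hbdd)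
  exact ((cdf μ).mono (csInf_le hbdd hx.ge)).trans_eq hx

theorem gaussianReal_Ioi_gaussianUpperQuantile {α : ℝ} (hα : α ∈ Set.Ioo (0 : ℝ) 1) :
    (gaussianReal 0 1).real (Set.Ioi (gaussianUpperQuantile α)) = α := by
  have : NullSingletonClass (gaussianReal 0 1) := nullSingletonClass_gaussianReal one_ne_zero
  rw [← Set.compl_Iic, probReal_compl_eq_one_sub measurableSet_Iic, ← cdf_eq_real,
    gaussianUpperQuantile, cdf_sInf_setOf_le_cdf _ ⟨by linarith [hα.2], by linarith [hα.1]⟩,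
    sub_sub_cancel]

end Quantile

section IndependentEntries

variable {Ω : Type*} [MeasurableSpace Ω] {P : Measure Ω} [IsProbabilityMeasure P]

theorem map_pi_pi_of_iIndepFun {α β S : Type*} [Fintype α] [Fintype β] [MeasurableSpace S]
    {A : α → β → Ω → S} (hA : ∀ a b, Measurable (A a b))
    (h : iIndepFun (fun q : α × β => A q.1 q.2) P) :
    P.map (fun ω a b => A a b ω) = Measure.pi fun a => Measure.pi fun b => P.map (A a b) := by
  have measurable_entries : Measurable fun ω (q : α × β) => A q.1 q.2 ω :=
    measurable_pi_lambda _ fun q => hA q.1 q.2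
  have (a : α) (b : β) : IsProbabilityMeasure (P.map (A a b)) :=
    Measure.isProbabilityMeasure_map (hA a b).aemeasurable
  calc P.map (fun ω a b => A a b ω)
      = (P.map fun ω (q : α × β) => A q.1 q.2 ω).map (MeasurableEquiv.curry α β S) := by
        rw [Measure.map_map (MeasurableEquiv.measurable _) measurable_entries]
        rfl
    _ = (Measure.infinitePi fun q : α × β => P.map (A q.1 q.2)).map
          (MeasurableEquiv.curry α β S) := by
        rw [h.map_fun_eq_infinitePi_map fun q : α × β => hA q.1 q.2]
    _ = Measure.pi fun a => Measure.pi fun b => P.map (A a b) := by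
        rw [Measure.infinitePi_map_curry fun a b => P.map (A a b)]
        simp only [Measure.infinitePi_eq_pi]

variable {f g : Ω → ℝ}

theorem one_le_lintegral_pow_four (hf : AEMeasurable f P) (hf₂ : ∫ ω, f ω ^ 2 ∂P = 1) :
    1 ≤ ∫⁻ ω, ENNReal.ofReal (f ω ^ 4) ∂P := by
  have integrable_sq : Integrable (fun ω => f ω ^ 2) P := by
    by_contra h
    simp [integral_undef h] at hf₂
  have lintegral_sq : ∫⁻ ω, ENNReal.ofReal (f ω ^ 2) ∂P = 1 := by
    rw [← ofReal_integral_eq_lintegral_ofReal integrable_sq (ae_of_all _ fun ω => sq_nonneg _),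
      hf₂, ENNReal.ofReal_one]
  have two_le : (1 + 1 : ENNReal) ≤ ∫⁻ ω, ENNReal.ofReal (f ω ^ 4) ∂P + 1 :=
    calc (1 + 1 : ENNReal)
        = ∫⁻ ω, (ENNReal.ofReal (f ω ^ 2) + ENNReal.ofReal (f ω ^ 2)) ∂P := by
          rw [lintegral_add_left' (by fun_prop), lintegral_sq]
      _ ≤ ∫⁻ ω, (ENNReal.ofReal (f ω ^ 4) + ENNReal.ofReal 1) ∂P := lintegral_mono fun ω => by
          rw [← ENNReal.ofReal_add (by positivity) (by positivity),
            ← ENNReal.ofReal_add (by positivity) (by positivity)]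
          exact ENNReal.ofReal_le_ofReal (by nlinarith [sq_nonneg (f ω ^ 2 - 1)])
      _ = ∫⁻ ω, ENNReal.ofReal (f ω ^ 4) ∂P + 1 := by
          rw [lintegral_add_left' (by fun_prop)]
          simp
  exact (ENNReal.add_le_add_iff_right ENNReal.one_ne_top).1 two_le

theorem lintegral_pow_four_le_of_indepFun (hf : AEMeasurable f P) (hg : AEMeasurable g P)
    (h : IndepFun f g P) (hg₂ : ∫ ω, g ω ^ 2 ∂P = 1) :
    ∫⁻ ω, ENNReal.ofReal (f ω ^ 4) ∂P ≤ ∫⁻ ω, ENNReal.ofReal ((f ω * g ω) ^ 4) ∂P :=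
  have indep_pow_four :
      IndepFun (fun ω => ENNReal.ofReal (f ω ^ 4)) (fun ω => ENNReal.ofReal (g ω ^ 4)) P :=
    h.comp (φ := fun x : ℝ => ENNReal.ofReal (x ^ 4)) (ψ := fun x : ℝ => ENNReal.ofReal (x ^ 4))
      (by fun_prop) (by fun_prop)
  calc ∫⁻ ω, ENNReal.ofReal (f ω ^ 4) ∂P
      ≤ (∫⁻ ω, ENNReal.ofReal (f ω ^ 4) ∂P) * ∫⁻ ω, ENNReal.ofReal (g ω ^ 4) ∂P :=
        le_mul_of_one_le_right' (one_le_lintegral_pow_four hg hg₂)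
    _ = ∫⁻ ω, ENNReal.ofReal (f ω ^ 4) * ENNReal.ofReal (g ω ^ 4) ∂P :=
        (lintegral_mul_eq_lintegral_mul_lintegral_of_indepFun'' (by fun_prop) (by fun_prop)
          indep_pow_four).symm
    _ = ∫⁻ ω, ENNReal.ofReal ((f ω * g ω) ^ 4) ∂P := by
        simp only [mul_pow, ENNReal.ofReal_mul (Even.pow_nonneg (by decide : Even 4) _)]

theorem isStandardized_map {C : NNReal} (hf : AEMeasurable f P) (hf₁ : ∫ ω, f ω ∂P = 0)
    (hf₂ : ∫ ω, f ω ^ 2 ∂P = 1) (hf₄ : ∫⁻ ω, ENNReal.ofReal (f ω ^ 4) ∂P ≤ C) :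
    IsStandardized C (P.map f) where
  isProbabilityMeasure := Measure.isProbabilityMeasure_map hf
  memLp := by
    refine (memLp_map_measure_iff (by fun_prop) hf).2
      ((memLp_four_iff_integrable_pow_four hf.aestronglyMeasurable).2 ?_)
    refine (lintegral_ofReal_ne_top_iff_integrable (by fun_prop)
      (ae_of_all _ fun ω => by positivity)).1 ?_
    exact ne_top_of_le_ne_top ENNReal.coe_ne_top hf₄
  mean := by rwa [integral_map hf (by fun_prop)]
  second_moment := by rwa [integral_map hf (by fun_prop)]
  fourth_moment_le := by
    rw [integral_map hf (by fun_prop), integral_eq_lintegral_of_nonneg_ae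
      (ae_of_all _ fun ω => by positivity) (by fun_prop)]
    exact ENNReal.toReal_mono ENNReal.coe_ne_top hf₄

end IndependentEntries

section Design

variable {n p : ℕ} {PX : Measure (Design n p)} [IsProbabilityMeasure PX]

theorem isStandardized_map_entry {C : NNReal} (hmean : ∀ i j, ∫ X, X i j ∂PX = 0)
    (hvar : ∀ i j, ∫ X, X i j ^ 2 ∂PX = 1) (hA : IndependentDesign PX) (hp : 2 ≤ p)
    (hC : ∀ (i : Fin n) (j j' : Fin p), j < j' →
      ∫⁻ X, ENNReal.ofReal ((X i j * X i j') ^ 4) ∂PX ≤ C) (i : Fin n) (j : Fin p) :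
    IsStandardized C (PX.map fun X => X i j) := by
  have measurable_entry (j : Fin p) : AEMeasurable (fun X : Design n p => X i j) PX :=
    Measurable.aemeasurable (by fun_prop)
  refine isStandardized_map (measurable_entry j) (hmean i j) (hvar i j) ?_
  have : Nontrivial (Fin p) := Fin.nontrivial_iff_two_le.2 hp
  obtain ⟨j', hj'⟩ := exists_ne j
  have indep : IndepFun (fun X : Design n p => X i j) (fun X : Design n p => X i j') PX :=
    hA.indepFun (i := (i, j)) (j := (i, j')) (by simpa using hj'.symm)
  refine (lintegral_pow_four_le_of_indepFun (measurable_entry j) (measurable_entry j') indep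
    (hvar i j')).trans ?_
  rcases lt_or_gt_of_ne hj' with h | h
  · simpa only [mul_comm] using hC i j' j h
  · exact hC i j j' h

theorem IndependentDesign.eq_pi_pi (hA : IndependentDesign PX) :
    PX = Measure.pi fun i => Measure.pi fun j => PX.map fun X => X i j := by
  simpa using map_pi_pi_of_iIndepFun (A := fun i j (X : Design n p) => X i j) (by fun_prop) hA

theorem IndependentDesign.map_transpose_eq_pi_pi (hA : IndependentDesign PX) :
    PX.map (fun X j i => X i j) = Measure.pi fun j => Measure.pi fun i => PX.map fun X => X i j :=
  map_pi_pi_of_iIndepFun (A := fun j i (X : Design n p) => X i j) (by fun_prop)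
    (hA.precomp (g := Prod.swap) Prod.swap_injective)

end Design

section Conditioning

variable {Ω₁ Ω₂ : Type*} [MeasurableSpace Ω₁] [MeasurableSpace Ω₂] {μ : Measure Ω₁} {ν : Measure Ω₂}
  [IsProbabilityMeasure μ] [IsProbabilityMeasure ν] {f : Ω₁ × Ω₂ → ℝ}

theorem norm_charFun_map_prod_sub_le (hf : Measurable f) {B : Ω₂ → ℝ} (hB : Integrable B ν) {t : ℝ}
    {c : ℂ} (h : ∀ y, ‖charFun (μ.map fun x => f (x, y)) t - c‖ ≤ B y) :
    ‖charFun ((μ.prod ν).map f) t - c‖ ≤ ∫ y, B y ∂ν := by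
  have integrable_exp : Integrable (fun z => Complex.exp ((t * f z : ℝ) * Complex.I)) (μ.prod ν) :=
    Integrable.of_bound (by fun_prop) 1 (ae_of_all _ fun z => (Complex.norm_exp_ofReal_mul_I _).le)
  have charFun_section (y : Ω₂) : charFun (μ.map fun x => f (x, y)) t =
      ∫ x, Complex.exp ((t * f (x, y) : ℝ) * Complex.I) ∂μ :=
    charFun_map_eq_integral (by fun_prop) t
  have charFun_sub : charFun ((μ.prod ν).map f) t - c =
      ∫ y, (charFun (μ.map fun x => f (x, y)) t - c) ∂ν := by
    simp only [charFun_section]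
    rw [charFun_map_eq_integral hf.aemeasurable, integral_prod_symm _ integrable_exp,
      integral_sub integrable_exp.integral_prod_right (integrable_const c), integral_const,
      probReal_univ, one_smul]
  rw [charFun_sub]
  exact norm_integral_le_of_norm_le hB (ae_of_all _ h)

end Conditioning

section NoiseMoments

variable {n : ℕ}

theorem sum_sq_pow_three_le (ξ : Fin n → ℝ) :
    (∑ i, ξ i ^ 2) ^ 3 ≤ (n : ℝ) ^ 2 * ∑ i, ξ i ^ 6 := by
  rcases n.eq_zero_or_pos with rfl | hn
  · simp
  have := pow_sum_div_card_le_sum_pow (s := Finset.univ) (f := fun i => ξ i ^ 2)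
    (fun i _ => sq_nonneg _) 2
  rw [Finset.card_univ, Fintype.card_fin, div_le_iff₀' (by positivity)] at this
  simpa only [← pow_mul] using this

theorem integrable_sum_sq_pow_three {ν : Measure ℝ} [IsProbabilityMeasure ν]
    (hν : Integrable (fun x => x ^ 6) ν) :
    Integrable (fun ξ : Fin n → ℝ => (∑ i, ξ i ^ 2) ^ 3) (Measure.pi fun _ => ν) := by
  have bound : Integrable (fun ξ : Fin n → ℝ => (n : ℝ) ^ 2 * ∑ i, ξ i ^ 6)
      (Measure.pi fun _ => ν) :=
    (integrable_finsetSum _ fun i _ =>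
      integrable_comp_eval (μ := fun _ : Fin n => ν) (i := i) hν).const_mul _
  refine bound.mono' (Measurable.aestronglyMeasurable (by fun_prop)) (ae_of_all _ fun ξ => ?_)
  rw [Real.norm_of_nonneg (by positivity)]
  exact sum_sq_pow_three_le ξ

theorem integral_sum_sq_pow_three_le {ν : Measure ℝ} [IsProbabilityMeasure ν]
    (hν : Integrable (fun x => x ^ 6) ν) :
    ∫ ξ : Fin n → ℝ, (∑ i, ξ i ^ 2) ^ 3 ∂Measure.pi (fun _ => ν) ≤ n ^ 3 * ∫ x, x ^ 6 ∂ν := by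
  have integrable_entry (i : Fin n) :
      Integrable (fun ξ : Fin n → ℝ => ξ i ^ 6) (Measure.pi fun _ => ν) :=
    integrable_comp_eval (μ := fun _ : Fin n => ν) hν
  have integral_entry (i : Fin n) :
      ∫ ξ : Fin n → ℝ, ξ i ^ 6 ∂Measure.pi (fun _ => ν) = ∫ x, x ^ 6 ∂ν :=
    integral_comp_eval (μ := fun _ : Fin n => ν) (i := i) (f := fun x => x ^ 6) (by fun_prop)
  calc ∫ ξ : Fin n → ℝ, (∑ i, ξ i ^ 2) ^ 3 ∂Measure.pi (fun _ => ν)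
      ≤ ∫ ξ : Fin n → ℝ, (n : ℝ) ^ 2 * ∑ i, ξ i ^ 6 ∂Measure.pi (fun _ => ν) :=
        integral_mono (integrable_sum_sq_pow_three hν)
          ((integrable_finsetSum _ fun i _ => integrable_entry i).const_mul _) sum_sq_pow_three_le
    _ = n ^ 3 * ∫ x, x ^ 6 ∂ν := by
        rw [integral_const_mul, integral_finsetSum _ fun i _ => integrable_entry i]
        simp only [integral_entry, Finset.sum_const, Finset.card_univ, Fintype.card_fin,
          nsmul_eq_mul]
        ring

theorem IsStandardized.hasMeanCovLE_map_sq {C : ℝ} {ν : Measure ℝ} (h : IsStandardized C ν) :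
    HasMeanCovLE (1 : ℝ) C (ν.map fun x => x ^ 2) := by
  have := h.isProbabilityMeasure
  have measurable_sq : AEMeasurable (fun x : ℝ => x ^ 2) ν := by fun_prop
  have memLp_sq : MemLp (fun x => x ^ 2) 2 ν := memLp_sq h.memLp
  refine ⟨Measure.isProbabilityMeasure_map measurable_sq,
    (memLp_map_measure_iff (by fun_prop) measurable_sq).2 memLp_sq, ?_, fun v => ?_⟩
  · rw [integral_map measurable_sq (by fun_prop), h.second_moment]
  · rw [variance_map (by fun_prop) measurable_sq]
    calc Var[fun x => v * x ^ 2; ν] = v ^ 2 * Var[fun x => x ^ 2; ν] := variance_const_mul _ _ _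
      _ ≤ v ^ 2 * ∫ x, (x ^ 2) ^ 2 ∂ν := by
          gcongr
          exact variance_le_expectation_sq memLp_sq.1
      _ ≤ C * ‖v‖ ^ 2 := by
          rw [Real.norm_eq_abs, sq_abs, mul_comm]
          gcongr
          simpa only [← pow_mul] using h.fourth_moment_le

section SquaredNoise

variable {C : ℝ} {ν : Fin n → Measure ℝ}

theorem measurePreserving_pi_sq [∀ i, SigmaFinite (ν i)]
    [∀ i, SigmaFinite ((ν i).map fun x => x ^ 2)] :
    MeasurePreserving (fun (ξ : Fin n → ℝ) i => ξ i ^ 2) (Measure.pi ν)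
      (Measure.pi fun i => (ν i).map fun x => x ^ 2) :=
  measurePreserving_pi ν _ fun i =>
    (by fun_prop : Measurable fun x : ℝ => x ^ 2).measurePreserving (ν i)

theorem memLp_pairInner_sq (hν : ∀ i, IsStandardized C (ν i)) :
    MemLp (fun ξ : Fin n → ℝ => pairInner fun i => ξ i ^ 2) 2 (Measure.pi ν) := by
  have := fun i => (hν i).isProbabilityMeasure
  have := fun i => (hν i).hasMeanCovLE_map_sq.isProbabilityMeasure
  exact (memLp_pairInner fun i => (hν i).hasMeanCovLE_map_sq).comp_measurePreserving
    measurePreserving_pi_sq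

theorem integral_abs_pairInner_sq_sub_le (hν : ∀ i, IsStandardized C (ν i)) :
    ∫ ξ : Fin n → ℝ, |(pairInner fun i => ξ i ^ 2) - (n : ℝ) * (n - 1) / 2| ∂Measure.pi ν ≤
      2 * C * n * √n := by
  have := fun i => (hν i).isProbabilityMeasure
  have := fun i => (hν i).hasMeanCovLE_map_sq.isProbabilityMeasure
  rcases n.eq_zero_or_pos with rfl | hn
  · simp [pairInner]
  have hC : 1 ≤ C := (hν ⟨0, hn⟩).one_le
  have hn₁ : (1 : ℝ) ≤ n := by exact_mod_cast hn
  have memLp_dev : MemLp (fun ξ : Fin n → ℝ => |(pairInner fun i => ξ i ^ 2) -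
      (n : ℝ) * (n - 1) / 2|) 2 (Measure.pi ν) := ((memLp_pairInner_sq hν).sub (memLp_const _)).abs
  have dev_sq_le : ∫ ξ : Fin n → ℝ, |(pairInner fun i => ξ i ^ 2) - (n : ℝ) * (n - 1) / 2| ^ 2
      ∂Measure.pi ν ≤ (2 * C * n * √n) ^ 2 := by
    calc _ = ∫ u : Fin n → ℝ, (pairInner u - (n : ℝ) * (n - 1) / 2 * ‖(1 : ℝ)‖ ^ 2) ^ 2
            ∂Measure.pi fun i => (ν i).map fun x => x ^ 2 := by
          rw [← measurePreserving_pi_sq.map_eq, integral_map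
            measurePreserving_pi_sq.aemeasurable
            (Measurable.aestronglyMeasurable (by unfold pairInner; fun_prop))]
          simp only [sq_abs, norm_one, one_pow, mul_one]
      _ ≤ 2 * n ^ 3 * (C * ‖(1 : ℝ)‖ ^ 2) + 2 * n ^ 2 * (C ^ 2 * Module.finrank ℝ ℝ) :=
          integral_pairInner_sub_mean_sq_le (zero_le_one.trans hC)
            fun i => (hν i).hasMeanCovLE_map_sq
      _ ≤ 2 * n ^ 3 * C ^ 2 + 2 * n ^ 3 * C ^ 2 := by
          rw [norm_one, one_pow, mul_one, Module.finrank_self, Nat.cast_one, mul_one]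
          gcongr
          · exact le_self_pow₀ hC (by norm_num)
          · norm_num
      _ = (2 * C * n * √n) ^ 2 := by
          rw [mul_pow _ (√n), Real.sq_sqrt (Nat.cast_nonneg n)]
          ring
  simpa using integral_mul_le_of_integral_sq_le memLp_dev (memLp_const 1) (by positivity)
    zero_le_one dev_sq_le (by simp)

end SquaredNoise

end NoiseMoments

section TypeOne

variable {n p : ℕ}

theorem response_zero (X : Design n p) (ξ : Fin n → ℝ) : response 0 X ξ = ξ := by
  ext i
  simp [response]

theorem statT1_eq_sum_columns (X : Design n p) (ξ : Fin n → ℝ) :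
    statT1 (X, ξ) =
      ∑ j, (√((n : ℝ) * (n - 1) / 2))⁻¹ * (√p)⁻¹ * pairInner fun i => ξ i * X i j := by
  simp only [statT1, kernelK, pairInner, Real.inner_apply, ← Finset.mul_sum]
  rw [Finset.sum_comm, mul_assoc]
  congr 2
  refine Finset.sum_congr rfl fun q _ => ?_
  rw [Finset.mul_sum]
  exact Finset.sum_congr rfl fun j _ => by ring

theorem typeIError_eq_measureReal (PX : Measure (Design n p)) (α : ℝ) :
    typeIError PX (testPsi1 n p α) =
      ((PX.prod (Measure.pi fun _ => gaussianReal 0 1)).map statT1).real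
        (Set.Ioi (gaussianUpperQuantile α)) := by
  have law_null : modelLaw PX 0 = PX.prod (Measure.pi fun _ => gaussianReal 0 1) := by
    simp only [modelLaw, response_zero, Measure.map_id']
  rw [typeIError, testPsi1,
    integral_indicator_one (measurableSet_lt measurable_const measurable_statT1), law_null,
    map_measureReal_apply measurable_statT1 measurableSet_Ioi]
  rfl

section ConditionalLaw

variable {C : ℝ} {ν : Fin p → Fin n → Measure ℝ}

theorem norm_charFun_sum_columns_sub_le (hν : ∀ j i, IsStandardized C (ν j i)) (hC : 0 ≤ C)
    (ξ : Fin n → ℝ) {a : ℝ} (ha : 0 ≤ a) (t : ℝ) :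
    ‖charFun ((Measure.pi fun j => Measure.pi (ν j)).map
          fun x => ∑ j, a * pairInner fun i => ξ i * x j i) t -
        (Real.exp (-(p * a ^ 2 * (pairInner fun i => ξ i ^ 2) * t ^ 2 / 2)) : ℂ)‖ ≤
      20 * C * |t| ^ 3 * (p * a ^ 3) * (∑ i, ξ i ^ 2) ^ 3 := by
  have := fun j i => (hν j i).isProbabilityMeasure
  have berryEsseen := norm_charFun_pi_sum_sub_exp_le (P := fun j => Measure.pi (ν j))
    (W := fun _ y => a * pairInner fun i => ξ i * y i)
    (fun j => ((memLp_pairInner_mul (hν j) ξ).mono_exponent (by norm_num)).const_mul a)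
    (fun j => by rw [integral_const_mul, integral_pairInner_mul (hν j), mul_zero]) t
  simp only [mul_pow, integral_const_mul, integral_pairInner_mul_sq (hν _), Finset.sum_const,
    Finset.card_univ, Fintype.card_fin, nsmul_eq_mul, ← mul_assoc (p : ℝ)] at berryEsseen
  calc _ ≤ 5 * |t| ^ 3 *
        ∑ j, ∫ y : Fin n → ℝ, |a * pairInner fun i => ξ i * y i| ^ 3 ∂Measure.pi (ν j) :=
        berryEsseen
    _ ≤ 5 * |t| ^ 3 * ∑ _j : Fin p, a ^ 3 * (4 * C * (∑ i, ξ i ^ 2) ^ 3) := by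
        gcongr with j
        simp only [abs_mul, mul_pow, abs_of_nonneg ha, integral_const_mul]
        gcongr
        exact integral_abs_pairInner_mul_pow_three_le (hν j) hC ξ
    _ = 20 * C * |t| ^ 3 * (p * a ^ 3) * (∑ i, ξ i ^ 2) ^ 3 := by
        rw [Finset.sum_const, Finset.card_univ, Fintype.card_fin, nsmul_eq_mul]
        ring

end ConditionalLaw

theorem norm_exp_neg_sub_charFun_gaussianReal_le {s : ℝ} (hs : 0 ≤ s) (t : ℝ) :
    ‖(Real.exp (-s) : ℂ) - charFun (gaussianReal 0 1) t‖ ≤ |s - t ^ 2 / 2| := by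
  have charFun_gaussian : charFun (gaussianReal 0 1) t = (Real.exp (-(t ^ 2 / 2)) : ℂ) := by
    rw [charFun_gaussianReal]
    push_cast
    ring_nf
  rw [charFun_gaussian, ← Complex.ofReal_sub, Complex.norm_real, Real.norm_eq_abs]
  exact abs_exp_neg_sub_exp_neg_le hs (by positivity)

theorem natCast_mul_inv_sqrt_sq (hp : 0 < p) {N : ℝ} (hN : 0 ≤ N) :
    p * ((√N)⁻¹ * (√p)⁻¹) ^ 2 = N⁻¹ := by
  have : (0 : ℝ) < p := by exact_mod_cast hp
  rw [mul_pow, inv_pow, inv_pow, Real.sq_sqrt hN, Real.sq_sqrt this.le]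
  field_simp

theorem natCast_mul_inv_sqrt_pow_three_le (hn : 2 ≤ n) (hp : 0 < p) :
    p * ((√((n : ℝ) * (n - 1) / 2))⁻¹ * (√p)⁻¹) ^ 3 ≤ 8 / (n ^ 3 * √p) := by
  have : (0 : ℝ) < n := by exact_mod_cast (by omega : 0 < n)
  have hp₀ : (0 : ℝ) < p := by exact_mod_cast hp
  have half_le_sqrt : (n : ℝ) / 2 ≤ √((n : ℝ) * (n - 1) / 2) :=
    Real.le_sqrt_of_sq_le (by linarith [sq_div_four_le_choose_two hn,
      show ((n : ℝ) / 2) ^ 2 = n ^ 2 / 4 by ring])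
  calc p * ((√((n : ℝ) * (n - 1) / 2))⁻¹ * (√p)⁻¹) ^ 3
      = (√((n : ℝ) * (n - 1) / 2) ^ 3 * √p)⁻¹ * (p / √p ^ 2) := by field_simp
    _ = (√((n : ℝ) * (n - 1) / 2) ^ 3 * √p)⁻¹ := by
        rw [Real.sq_sqrt hp₀.le, div_self hp₀.ne', mul_one]
    _ ≤ (((n : ℝ) / 2) ^ 3 * √p)⁻¹ := by gcongr
    _ = 8 / (n ^ 3 * √p) := by
        field_simp
        norm_num

variable {C : ℝ} {ν : Fin p → Fin n → Measure ℝ} {PX : Measure (Design n p)}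

theorem norm_charFun_statT1_sub_le (hν : ∀ j i, IsStandardized C (ν j i)) (hC : 0 ≤ C)
    (hPX : PX.map (fun X j i => X i j) = Measure.pi fun j => Measure.pi (ν j))
    (hn : 2 ≤ n) (hp : 0 < p) (ξ : Fin n → ℝ) (t : ℝ) :
    ‖charFun (PX.map fun X => statT1 (X, ξ)) t - charFun (gaussianReal 0 1) t‖ ≤
      160 * C * |t| ^ 3 / (n ^ 3 * √p) * (∑ i, ξ i ^ 2) ^ 3 +
        2 * t ^ 2 / n ^ 2 * |(pairInner fun i => ξ i ^ 2) - (n : ℝ) * (n - 1) / 2| := by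
  have : (0 : ℝ) < n := by exact_mod_cast (by omega : 0 < n)
  have sq_div_four_le := sq_div_four_le_choose_two hn
  have third_moment_scale := natCast_mul_inv_sqrt_pow_three_le hn hp
  set N := (n : ℝ) * (n - 1) / 2
  set V := pairInner fun i => ξ i ^ 2
  set a := (√N)⁻¹ * (√p)⁻¹
  have hN : 0 < N := lt_of_lt_of_le (by positivity) sq_div_four_le
  have hV : 0 ≤ V := Finset.sum_nonneg fun q _ => by
    rw [Real.inner_apply]
    positivity
  have law_statT1 : PX.map (fun X => statT1 (X, ξ)) = (Measure.pi fun j => Measure.pi (ν j)).map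
      fun x => ∑ j, a * pairInner fun i => ξ i * x j i := by
    rw [← hPX, Measure.map_map (by unfold pairInner; fun_prop) (by fun_prop)]
    simp only [statT1_eq_sum_columns]
    rfl
  have variance_sub : ‖(Real.exp (-(p * a ^ 2 * V * t ^ 2 / 2)) : ℂ) -
      charFun (gaussianReal 0 1) t‖ ≤ 2 * t ^ 2 / n ^ 2 * |V - N| :=
    calc _ ≤ |p * a ^ 2 * V * t ^ 2 / 2 - t ^ 2 / 2| :=
          norm_exp_neg_sub_charFun_gaussianReal_le (by positivity) t
      _ = t ^ 2 / 2 * N⁻¹ * |V - N| := by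
          rw [natCast_mul_inv_sqrt_sq hp hN.le,
            ← abs_of_nonneg (by positivity : 0 ≤ t ^ 2 / 2 * N⁻¹), ← abs_mul]
          congr 1
          field_simp
      _ ≤ t ^ 2 / 2 * ((n : ℝ) ^ 2 / 4)⁻¹ * |V - N| := by gcongr
      _ = 2 * t ^ 2 / n ^ 2 * |V - N| := by
          field_simp
          norm_num
  rw [law_statT1]
  refine (norm_sub_le_norm_sub_add_norm_sub _ _ _).trans (add_le_add ?_ variance_sub)
  refine (norm_charFun_sum_columns_sub_le hν hC ξ (by positivity) t).trans ?_
  calc _ ≤ 20 * C * |t| ^ 3 * (8 / (n ^ 3 * √p)) * (∑ i, ξ i ^ 2) ^ 3 := by gcongr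
    _ = _ := by ring

theorem integrable_pow_six_gaussianReal : Integrable (fun x => x ^ 6) (gaussianReal 0 1) := by
  simpa [Even.pow_abs (by decide : Even 6)] using
    (memLp_id_gaussianReal (μ := 0) (v := 1) 6).integrable_norm_pow (by norm_num)

theorem norm_charFun_map_statT1_sub_le [IsProbabilityMeasure PX]
    (hν : ∀ j i, IsStandardized C (ν j i)) (hC : 0 ≤ C)
    (hPX : PX.map (fun X j i => X i j) = Measure.pi fun j => Measure.pi (ν j))
    (hn : 2 ≤ n) (hp : 0 < p) (t : ℝ) :
    ‖charFun ((PX.prod (Measure.pi fun _ => gaussianReal 0 1)).map statT1) t -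
        charFun (gaussianReal 0 1) t‖ ≤
      (160 * C * |t| ^ 3 * (∫ x, x ^ 6 ∂gaussianReal 0 1) +
        4 * t ^ 2 * ∫ x, x ^ 4 ∂gaussianReal 0 1) * (1 / √p + 1 / √n) := by
  have hn₀ : (0 : ℝ) < n := by exact_mod_cast (by omega : 0 < n)
  have integrable_dev : Integrable (fun ξ : Fin n → ℝ => 2 * t ^ 2 / n ^ 2 *
      |(pairInner fun i => ξ i ^ 2) - (n : ℝ) * (n - 1) / 2|)
      (Measure.pi fun _ => gaussianReal 0 1) :=
    (((memLp_pairInner_sq fun _ : Fin n => isStandardized_gaussianReal).sub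
      (memLp_const _)).abs.integrable (by norm_num)).const_mul _
  have integrable_cube := (integrable_sum_sq_pow_three (n := n)
    integrable_pow_six_gaussianReal).const_mul (160 * C * |t| ^ 3 / (n ^ 3 * √p))
  refine (norm_charFun_map_prod_sub_le measurable_statT1
    (by exact integrable_cube.add integrable_dev)
    fun ξ => norm_charFun_statT1_sub_le hν hC hPX hn hp ξ t).trans ?_
  set M₄ := ∫ x, x ^ 4 ∂gaussianReal 0 1
  set M₆ := ∫ x, x ^ 6 ∂gaussianReal 0 1
  have : 0 ≤ M₄ := integral_nonneg fun x => by positivity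
  have : 0 ≤ M₆ := integral_nonneg fun x => by positivity
  calc _ = 160 * C * |t| ^ 3 / (n ^ 3 * √p) *
            ∫ ξ : Fin n → ℝ, (∑ i, ξ i ^ 2) ^ 3 ∂Measure.pi (fun _ => gaussianReal 0 1) +
          2 * t ^ 2 / n ^ 2 * ∫ ξ : Fin n → ℝ, |(pairInner fun i => ξ i ^ 2) -
            (n : ℝ) * (n - 1) / 2| ∂Measure.pi (fun _ => gaussianReal 0 1) := by
        rw [integral_add integrable_cube integrable_dev, integral_const_mul, integral_const_mul]
    _ ≤ 160 * C * |t| ^ 3 / (n ^ 3 * √p) * (n ^ 3 * M₆) +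
          2 * t ^ 2 / n ^ 2 * (2 * M₄ * n * √n) := by
        gcongr
        · exact integral_sum_sq_pow_three_le integrable_pow_six_gaussianReal
        · exact integral_abs_pairInner_sq_sub_le fun _ => isStandardized_gaussianReal
    _ = 160 * C * |t| ^ 3 * M₆ * (1 / √p) + 4 * t ^ 2 * M₄ * (1 / √n) := by
        rw [show (2 * M₄ * n * √n : ℝ) = 2 * M₄ * n * (√n ^ 2 / √n) by field_simp,
          Real.sq_sqrt hn₀.le]
        field_simp
        ring
    _ ≤ (160 * C * |t| ^ 3 * M₆ + 4 * t ^ 2 * M₄) * (1 / √p + 1 / √n) := by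
        rw [add_mul, mul_add, mul_add]
        have : 0 ≤ 160 * C * |t| ^ 3 * M₆ * (1 / √n) := by positivity
        have : 0 ≤ 4 * t ^ 2 * M₄ * (1 / √p) := by positivity
        linarith

end TypeOne

theorem tendsto_one_div_sqrt_natCast {ι : Type*} {l : Filter ι} {n : ι → ℕ}
    (hn : Tendsto n l atTop) : Tendsto (fun m => 1 / √(n m)) l (𝓝 0) := by
  simp only [one_div]
  exact (Real.tendsto_sqrt_atTop.comp (tendsto_natCast_atTop_atTop.comp hn)).inv_tendsto_atTop

theorem tendsto_typeIError_of_isStandardized {ι : Type*} {l : Filter ι} {n p : ι → ℕ} {C : ℝ}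
    (hC : 0 ≤ C) (hn : Tendsto n l atTop) (hp : Tendsto p l atTop)
    {PX : ∀ m, Measure (Design (n m) (p m))} [∀ m, IsProbabilityMeasure (PX m)]
    (hPX : ∀ᶠ m in l, ∃ ν : Fin (p m) → Fin (n m) → Measure ℝ,
      (∀ j i, IsStandardized C (ν j i)) ∧
      (PX m).map (fun X j i => X i j) = Measure.pi fun j => Measure.pi (ν j))
    {α : ℝ} (hα : α ∈ Set.Ioo (0 : ℝ) 1) :
    Tendsto (fun m => typeIError (PX m) (testPsi1 (n m) (p m) α)) l (𝓝 α) := by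
  let γ : ProbabilityMeasure ℝ := ⟨gaussianReal 0 1, inferInstance⟩
  have : NullSingletonClass (γ : Measure ℝ) := nullSingletonClass_gaussianReal (by norm_num)
  let law (m : ι) : ProbabilityMeasure ℝ :=
    ⟨((PX m).prod (Measure.pi fun _ => gaussianReal 0 1)).map statT1,
      Measure.isProbabilityMeasure_map measurable_statT1.aemeasurable⟩
  have rate : Tendsto (fun m => 1 / √(p m) + 1 / √(n m)) l (𝓝 0) := by
    simpa using (tendsto_one_div_sqrt_natCast hp).add (tendsto_one_div_sqrt_natCast hn)
  have tendsto_law : Tendsto law l (𝓝 γ) := by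
    refine tendsto_of_norm_charFun_sub_le
      (K := fun t => 160 * C * |t| ^ 3 * (∫ x, x ^ 6 ∂gaussianReal 0 1) +
        4 * t ^ 2 * ∫ x, x ^ 4 ∂gaussianReal 0 1) rate ?_
    filter_upwards [hPX, hn.eventually_ge_atTop 2, hp.eventually_gt_atTop 0]
      with m ⟨ν, hν, hmap⟩ hnm hpm
    exact fun t => norm_charFun_map_statT1_sub_le hν hC hmap hnm hpm t
  have := tendsto_measureReal_Ioi tendsto_law (gaussianUpperQuantile α)
  simpa only [law, γ, typeIError_eq_measureReal, ProbabilityMeasure.coe_mk,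
    gaussianReal_Ioi_gaussianUpperQuantile hα] using this

end SparseRegression

theorem theorem3_general {ι : Type*} (l : Filter ι) (n p : ι → ℕ)
    (hn : Tendsto n l atTop) (hp : Tendsto p l atTop)
    (PX : ∀ m, Measure (SparseRegression.Design (n m) (p m)))
    [∀ m, IsProbabilityMeasure (PX m)]
    (hmean : ∀ m i j, ∫ X, X i j ∂PX m = 0) (hvar : ∀ m i j, ∫ X, X i j ^ 2 ∂PX m = 1)
    (hA2 : ∀ m, SparseRegression.IndependentDesign (PX m))
    (hB1 : SparseRegression.BoundedProductMoments l n p PX)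
    (α : ℝ) (hα : α ∈ Set.Ioo (0 : ℝ) 1) :
    Tendsto (fun m =>
        SparseRegression.typeIError (PX m) (SparseRegression.testPsi1 (n m) (p m) α)) l (𝓝 α) ∧
    ((fun m => (p m : ℝ)) =o[l] (fun m => (n m : ℝ) ^ 2) →
      ∀ r : ι → ℝ, (∀ m, 0 < r m) →
        Tendsto (fun m => (n m : ℝ) * r m ^ 2 / Real.sqrt (p m)) l atTop →
        Tendsto (fun m =>
          SparseRegression.typeIIError (PX m) (SparseRegression.testPsi1 (n m) (p m) α)
            (SparseRegression.alternative (p m) (r m))) l (𝓝 0)) := by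
  obtain ⟨C, hC⟩ := hB1
  have standardized : ∀ᶠ m in l, ∀ i j,
      SparseRegression.IsStandardized C ((PX m).map fun X => X i j) := by
    filter_upwards [hC, hp.eventually_ge_atTop 2] with m hCm hpm
    exact SparseRegression.isStandardized_map_entry (hmean m) (hvar m) (hA2 m) hpm hCm
  refine ⟨SparseRegression.tendsto_typeIError_of_isStandardized C.coe_nonneg hn hp ?_ hα,
    fun hpn r hr₀ hr =>
      SparseRegression.tendsto_typeIIError_of_isStandardized C.coe_nonneg ?_ hpn hr₀ hr⟩
  · filter_upwards [standardized] with m hm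
    exact ⟨_, fun j i => hm i j, (hA2 m).map_transpose_eq_pi_pi⟩
  · filter_upwards [standardized, hn.eventually_ge_atTop 2, hp.eventually_ge_atTop 2]
      with m hm hnm hpm
    exact ⟨hnm, hpm, _, hm, (hA2 m).eq_pi_pi⟩

theorem theorem3 {ι : Type*} (l : Filter ι) (n p : ι → ℕ)
    (hn : Tendsto n l atTop) (hp : Tendsto p l atTop)
    (PX : ∀ m, Measure (SparseRegression.Design (n m) (p m)))
    [∀ m, IsProbabilityMeasure (PX m)]
    (hX : ∀ m, SparseRegression.IsStandardDesign (PX m))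
    (hA2 : ∀ m, SparseRegression.IndependentDesign (PX m))
    (hB1 : SparseRegression.BoundedProductMoments l n p PX)
    (α : ℝ) (hα : α ∈ Set.Ioo (0 : ℝ) 1) :
    Tendsto (fun m =>
        SparseRegression.typeIError (PX m) (SparseRegression.testPsi1 (n m) (p m) α)) l (𝓝 α) ∧
    ((fun m => (p m : ℝ)) =o[l] (fun m => (n m : ℝ) ^ 2) →
      ∀ r : ι → ℝ, (∀ m, 0 < r m) →
        Tendsto (fun m => (n m : ℝ) * r m ^ 2 / Real.sqrt (p m)) l atTop →
        Tendsto (fun m =>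
          SparseRegression.typeIIError (PX m) (SparseRegression.testPsi1 (n m) (p m) α)
            (SparseRegression.alternative (p m) (r m))) l (𝓝 0)) :=
  theorem3_general l n p hn hp PX (fun m => (hX m).mean_zero) (fun m => (hX m).second_moment_one)
    hA2 hB1 α hα
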